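/- **Setting.** Fix $k,m,t,u$ and a constrained latent class model for $k$ binary items with $m$ latent classes and parameter $\theta=(\lambda,\eta)\in\Theta\subseteq\mathbb R^{t+u}$: for fixed real constants $q_{jir},c_{ji},v_{jr},d_j$, $$p_{ji}=\frac{\exp(\sum_{r=1}^t q_{jir}\lambda_r+c_{ji})}{1+\exp(\sum_{r=1}^t q_{jir}\lambda_r+c_{ji})},\qquad w_j=\frac{\exp(\sum_{r=1}^u v_{jr}\eta_r+d_j)}{\sum_{h=1}^m\exp(\sum_{r=1}^u v_{hr}\eta_r+d_h)},$$ and the probability of the answer pattern $y\in\{0,1\}^k$ is $p_y(\theta)=\sum_{j=1}^m w_j\prod_{i=1}^k p_{ji}^{y_i}(1-p_{ji})^{1-y_i}$; write $p(\theta)=(p_y(\theta))_{y\in\{0,1\}^k}$. Let the true value $\theta_0$ be an interior point of $\Theta$, let the answer patterns of the sampled persons be independent with law $p(\theta_0)$, let $N_y$ be the number of persons with pattern $y$ among the first $N$, and let $\hat p=(N_y/N)_y$ be the vector of sample proportions. Let $\phi:(0,\infty)\to\mathbb R$ be convex and twice continuously differentiable with $\phi(1)=0$ and $\phi''(1)\neq0$,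 and let $D_\phi(p,q)=\sum_y q_y\,\phi(p_y/q_y)$, where $\phi(0)=\lim_{x\to0+}\phi(x)\in(-\infty,\infty]$, $0\,\phi(0/0)=0$ and $0\,\phi(p/0)=p\lim_{x\to\infty}\phi(x)/x$ for $p>0$. A minimum $\phi$-divergence estimator is a sequence of random vectors $\hat\theta_\phi=\hat\theta_\phi(N)$ such that, for each $N\ge1$, almost surely $\hat\theta_\phi$ minimizes $\theta\mapsto D_\phi(\hat p,p(\theta))$ over $\Theta$ whenever the sample admits a minimizer. A maximum likelihood estimator (MLE) is defined in the same way, as a maximizer over $\Theta$ of $\sum_y N_y\log p_y(\theta)$. Assume Birch's conditions: (i) $p_y(\theta_0)>0$ for all $y$; (ii) $p$ is continuous and totally differentiable at $\theta_0$; (iii) the $2^k\times(t+u)$ Jacobian matrix $J(\theta_0)$ of $p$ at $\theta_0$ has rank $t+u$; (iv) the inverse of $p:\Theta\to p(\Theta)$ is continuous at $p(\theta_0)$, i.e. for every $\varepsilon>0$ there is $\delta>0$ such that $\|\theta-\theta_0\|<\varepsilon$ for all $\theta\in\Theta$ with $\|p(\theta)-p(\theta_0)\|<\delta$. **Theorem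 2.** Let $A(\theta_0)=\operatorname{diag}(p(\theta_0))^{-1/2}J(\theta_0)$. Then $A(\theta_0)^TA(\theta_0)$ is positive definite and equals the Fisher information matrix (of one observation) $\left(\sum_y p_y(\theta_0)\,\partial_r\log p_y(\theta_0)\,\partial_s\log p_y(\theta_0)\right)_{r,s}$, and every minimum $\phi$-divergence estimator satisfies $$\sqrt N\,(\hat\theta_\phi-\theta_0)\xrightarrow[N\to\infty]{\mathcal L}\mathcal N\left(0,(A(\theta_0)^TA(\theta_0))^{-1}\right).$$ Every MLE $\tilde\theta$ has the same limit law, $\sqrt N\,(\tilde\theta-\theta_0)\xrightarrow{\mathcal L}\mathcal N\left(0,(A(\theta_0)^TA(\theta_0))^{-1}\right)$. Thus every minimum $\phi$-divergence estimator is best asymptotically normal, in the sense that its asymptotic covariance matrix is the inverse Fisher information, as for the MLE. -/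

import Mathlib

open MeasureTheory ProbabilityTheory Filter Topology
open scoped Matrix

noncomputable section

/-- An answer pattern: `true` is a correct answer (`1`), `false` a wrong one (`0`).
There are `2 ^ k` patterns. -/
abbrev AnswerPattern (k : ℕ) : Type := Fin k → Bool

/-- The parameter `θ = (lambda, eta)`, a vector of `ℝ ^ (t + u)`. -/
abbrev LCMParam (t u : ℕ) : Type := EuclideanSpace ℝ (Fin t ⊕ Fin u)

/-- The fixed constants of a constrained latent class model for `k` binary items, with `m` latent
classes and `t + u` parameters. -/
structure BinaryLCM (k m t u : ℕ) where
  /-- `Q j i r`: relevance of `lambda_r` for item `i` in class `j` -/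
  Q : Fin m → Fin k → Fin t → ℝ
  /-- offsets for the item probabilities -/
  C : Fin m → Fin k → ℝ
  /-- `V j r`: relevance of `eta_r` for the size of class `j` -/
  V : Fin m → Fin u → ℝ
  /-- offsets for the class sizes -/
  d : Fin m → ℝ

namespace BinaryLCM

variable {k m t u : ℕ}

/-- The linear predictor of item `i` in class `j`. -/
def itemPredictor (M : BinaryLCM k m t u) (θ : LCMParam t u) (j : Fin m) (i : Fin k) : ℝ :=
  ∑ r, M.Q j i r * θ (Sum.inl r) + M.C j i

/-- The linear predictor of the size of class `j`. -/
def classPredictor (M : BinaryLCM k m t u) (θ : LCMParam t u) (j : Fin m) : ℝ :=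
  ∑ r, M.V j r * θ (Sum.inr r) + M.d j

/-- The probability of a right answer to item `i` in class `j`. -/
def itemProb (M : BinaryLCM k m t u) (θ : LCMParam t u) (j : Fin m) (i : Fin k) : ℝ :=
  Real.exp (M.itemPredictor θ j i) / (1 + Real.exp (M.itemPredictor θ j i))

/-- The relative size of class `j`. -/
def classWeight (M : BinaryLCM k m t u) (θ : LCMParam t u) (j : Fin m) : ℝ :=
  Real.exp (M.classPredictor θ j) / ∑ h, Real.exp (M.classPredictor θ h)

/-- The manifest probability vector `p(θ)`, indexed by the answer patterns. -/
def manifestProb (M : BinaryLCM k m t u) (θ : LCMParam t u) (y : AnswerPattern k) : ℝ :=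
  ∑ j, M.classWeight θ j *
    ∏ i, (if y i = true then M.itemProb θ j i else 1 - M.itemProb θ j i)

/-- The Jacobian matrix of `p` at `θ`. -/
def jacobian (M : BinaryLCM k m t u) (θ : LCMParam t u) :
    Matrix (AnswerPattern k) (Fin t ⊕ Fin u) ℝ :=
  Matrix.of fun y s =>
    fderiv ℝ (fun θ' : LCMParam t u => M.manifestProb θ' y) θ (EuclideanSpace.single s 1)

/-- The matrix `A(θ) = diag(p(θ))^(-1/2) J(θ)`. -/
def scaledJacobian (M : BinaryLCM k m t u) (θ : LCMParam t u) :
    Matrix (AnswerPattern k) (Fin t ⊕ Fin u) ℝ :=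
  Matrix.diagonal (fun y => (Real.sqrt (M.manifestProb θ y))⁻¹) * M.jacobian θ

/-- The component of the score `∂ log p(y, θ) / ∂ s`. -/
def score (M : BinaryLCM k m t u) (θ : LCMParam t u) (y : AnswerPattern k)
    (s : Fin t ⊕ Fin u) : ℝ :=
  fderiv ℝ (fun θ' : LCMParam t u => Real.log (M.manifestProb θ' y)) θ
    (EuclideanSpace.single s 1)

/-- The Fisher information matrix (of one observation) at `θ`: the expectation under `p(θ)` of the
products of the score components. -/
def fisherInformation (M : BinaryLCM k m t u) (θ : LCMParam t u) :
    Matrix (Fin t ⊕ Fin u) (Fin t ⊕ Fin u) ℝ :=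
  Matrix.of fun r s => ∑ y, M.manifestProb θ y * (M.score θ y r * M.score θ y s)

/-- Birch's conditions at `θ₀` for the parameter space `Θ`. The last one says that the inverse of
`p : Θ → Δ` is continuous at `p(θ₀)`: parameters in `Θ` whose manifest probabilities are close to
`p(θ₀)` are close to `θ₀`. -/
structure BirchConditions (M : BinaryLCM k m t u) (Θ : Set (LCMParam t u))
    (θ₀ : LCMParam t u) : Prop where
  pos : ∀ y, 0 < M.manifestProb θ₀ y
  continuousAt : ContinuousAt M.manifestProb θ₀
  differentiableAt : DifferentiableAt ℝ M.manifestProb θ₀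
  rank_jacobian : (M.jacobian θ₀).rank = t + u
  inverse_continuousAt : ∀ ε > 0, ∃ δ > 0, ∀ θ ∈ Θ,
    dist (M.manifestProb θ) (M.manifestProb θ₀) < δ → dist θ θ₀ < ε

end BinaryLCM

section Divergence

/-- The class of admissible functions: convex on `(0, ∞)` and vanishing at `1`. -/
def IsDivergenceFunction (φ : ℝ → ℝ) : Prop :=
  ConvexOn ℝ (Set.Ioi 0) φ ∧ φ 1 = 0

/-- `φ` on `[0, ∞)`, with `φ(0) = lim_{x → 0+} φ(x)`, possibly `+∞`. -/
def phiExt (φ : ℝ → ℝ) (x : ℝ) : EReal :=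
  if x = 0 then limUnder (𝓝[>] (0 : ℝ)) (fun z => (φ z : EReal)) else (φ x : EReal)

/-- The summand `q φ(p / q)`, with `0 φ(0 / 0) = 0` and
`0 φ(p / 0) = p lim_{x → ∞} φ(x) / x` for `p > 0`. -/
def phiTerm (φ : ℝ → ℝ) (p q : ℝ) : EReal :=
  if q = 0 then
    if p = 0 then 0 else (p : EReal) * limUnder atTop (fun x : ℝ => ((φ x / x : ℝ) : EReal))
  else (q : EReal) * phiExt φ (p / q)

/-- The `φ`-divergence `D_φ(p, q)` between two probability vectors. -/
def phiDivergence {ι : Type*} [Fintype ι] (φ : ℝ → ℝ) (p q : ι → ℝ) : EReal :=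
  ∑ ν, phiTerm φ (p ν) (q ν)

end Divergence

section Estimators

variable {k m t u : ℕ} {Ω : Type*}

/-- `N_y`: how many of the first `N` persons give the answer pattern `y`. -/
def patternCount (Y : ℕ → Ω → AnswerPattern k) (N : ℕ) (ω : Ω) (y : AnswerPattern k) : ℕ :=
  ((Finset.range N).filter fun v => Y v ω = y).card

/-- The vector of sample proportions. -/
def sampleProportion (Y : ℕ → Ω → AnswerPattern k) (N : ℕ) (ω : Ω) (y : AnswerPattern k) : ℝ :=
  (patternCount Y N ω y : ℝ) / N

/-- The log-likelihood of the first `N` answer patterns, up to the constant that comes from the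
multinomial coefficient. -/
def logLikelihood (M : BinaryLCM k m t u) (Y : ℕ → Ω → AnswerPattern k) (N : ℕ) (ω : Ω)
    (θ : LCMParam t u) : ℝ :=
  ∑ y, (patternCount Y N ω y : ℝ) * Real.log (M.manifestProb θ y)

/-- `Y 0, Y 1, …` are the independent answer patterns of persons drawn from the population that the
model describes at the parameter `θ₀`. -/
structure IsLCMSample [MeasurableSpace Ω] (M : BinaryLCM k m t u) (θ₀ : LCMParam t u)
    (μ : Measure Ω) (Y : ℕ → Ω → AnswerPattern k) : Prop where
  measurable : ∀ v, Measurable (Y v)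
  indep : iIndepFun Y μ
  law : ∀ v y, μ.real (Y v ⁻¹' {y}) = M.manifestProb θ₀ y

/-- `θhat N` is, for each sample size `N ≥ 1`, almost surely a minimizer over `Θ` of the
`φ`-divergence between the sample proportions and `p(θ)`, for every sample for which there is such
a minimizer. -/
def IsMinPhiDivergenceEstimator [MeasurableSpace Ω] (M : BinaryLCM k m t u)
    (Θ : Set (LCMParam t u)) (φ : ℝ → ℝ) (μ : Measure Ω) (Y : ℕ → Ω → AnswerPattern k)
    (θhat : ℕ → Ω → LCMParam t u) : Prop :=
  (∀ N, AEMeasurable (θhat N) μ) ∧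
  ∀ N ≥ 1, ∀ᵐ ω ∂μ,
    (∃ θ ∈ Θ, IsMinOn (fun θ' => phiDivergence φ (sampleProportion Y N ω) (M.manifestProb θ')) Θ θ) →
    θhat N ω ∈ Θ ∧
      IsMinOn (fun θ' => phiDivergence φ (sampleProportion Y N ω) (M.manifestProb θ')) Θ (θhat N ω)

/-- `θhat N` is, for each sample size `N ≥ 1`, almost surely a maximizer over `Θ` of the
log-likelihood, for every sample for which there is such a maximizer. -/
def IsMaxLikelihoodEstimator [MeasurableSpace Ω] (M : BinaryLCM k m t u)
    (Θ : Set (LCMParam t u)) (μ : Measure Ω) (Y : ℕ → Ω → AnswerPattern k)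
    (θhat : ℕ → Ω → LCMParam t u) : Prop :=
  (∀ N, AEMeasurable (θhat N) μ) ∧
  ∀ N ≥ 1, ∀ᵐ ω ∂μ,
    (∃ θ ∈ Θ, IsMaxOn (logLikelihood M Y N ω) Θ θ) →
    θhat N ω ∈ Θ ∧ IsMaxOn (logLikelihood M Y N ω) Θ (θhat N ω)

end Estimators

end

/-! Near `p(θ₀)` every `φ`-divergence is, up to a positive factor, the same weighted squared
distance, so all its minimizers share one linear approximation, that of least squares. Subtracting
the tangent line of `φ` at `1` does not change the divergence of probability vectors and gives a
convex function with a nondegenerate minimum there. The divergence is then `κ‖S(P - q)‖²` to second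
order, with `S = diag(p(θ₀))^(-1/2)`, and by convexity it dominates `c‖P - q‖²` for all positive
probability vectors (`exists_realDivergence_lower_bound`). Hence a minimizer `θ` for `P` near
`p(θ₀)` has `p(θ) - p(θ₀) = O(P - p(θ₀))`; continuity of the inverse brings `θ` close to `θ₀`, and
compactness gives existence. Comparison with the least squares candidate and Pythagoras yield `θ -
θ₀ = L S (P - p(θ₀)) + o(P - p(θ₀))`, where `L = (AᵀA)⁻¹Aᵀ` (`isLittleO_sub_leastSquares`). This is
deterministic. Probability enters through the central limit theorem for `√N L S (p̂ - p(θ₀))`, whose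
covariance is `L Lᵀ = (AᵀA)⁻¹`, and a Chebyshev bound that makes the remainder negligible. Maximum
likelihood is the case `φ(x) = x log x`. -/

/-! ### Scalar estimates for the divergence function -/

section DivergenceFunction

variable {φ ψ : ℝ → ℝ} {κ : ℝ}

/-- The second order expansion of a `C²` function on `(0, ∞)` at `1`. -/
lemma isLittleO_sub_taylor_two_at_one (hφ : ContDiffOn ℝ 2 φ (Set.Ioi 0)) :
    (fun x => φ x - φ 1 - deriv φ 1 * (x - 1) - deriv (deriv φ) 1 / 2 * (x - 1) ^ 2)
      =o[𝓝 1] fun x => (x - 1) ^ 2 := by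
  have h1 : (1 : ℝ) ∈ Set.Ioi (0 : ℝ) := by simp
  have h := taylor_isLittleO (convex_Ioi 0) h1 hφ
  rw [nhdsWithin_eq_nhds.2 (isOpen_Ioi.mem_nhds h1)] at h
  refine h.congr_left fun x => ?_
  rw [taylorWithinEval_succ, taylorWithinEval_succ, taylor_within_zero_eval,
    iteratedDerivWithin_of_isOpen_eq_iterate isOpen_Ioi h1,
    iteratedDerivWithin_of_isOpen_eq_iterate isOpen_Ioi h1]
  simp
  ring

lemma tangent_line_le (hφ : ConvexOn ℝ (Set.Ioi 0) φ) (hd : DifferentiableAt ℝ φ 1) {x : ℝ}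
    (hx : 0 < x) : φ 1 + deriv φ 1 * (x - 1) ≤ φ x := by
  have h1 : (1 : ℝ) ∈ Set.Ioi (0 : ℝ) := by simp
  rcases lt_trichotomy x 1 with h | h | h
  · have := hφ.slope_le_deriv (x := x) (y := 1) hx h1 h hd
    rw [slope_def_field, div_le_iff₀ (by linarith)] at this
    linarith
  · simp [h]
  · have := hφ.deriv_le_slope (x := 1) (y := x) h1 hx h hd
    rw [slope_def_field, le_div_iff₀ (by linarith)] at this
    linarith

/-- A convex `C²` function on `(0, ∞)` with nonzero second derivative at `1` has a positive one. -/
lemma deriv_deriv_one_pos (hφ : ConvexOn ℝ (Set.Ioi 0) φ) (hC : ContDiffOn ℝ 2 φ (Set.Ioi 0))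
    (h0 : deriv (deriv φ) 1 ≠ 0) : 0 < deriv (deriv φ) 1 := by
  by_contra hneg
  have hlt : deriv (deriv φ) 1 < 0 := lt_of_le_of_ne (not_lt.1 hneg) h0
  have hd : DifferentiableAt ℝ φ 1 :=
    (hC.differentiableOn (by norm_num)).differentiableAt (isOpen_Ioi.mem_nhds (by simp))
  -- The error constant is half the size of the quadratic coefficient, so a negative `φ''(1)` would
  -- push the graph strictly below its tangent line.
  have h := (isLittleO_sub_taylor_two_at_one hC).def (c := -(deriv (deriv φ) 1) / 4) (by linarith)
  obtain ⟨ε, hε, h⟩ := Metric.eventually_nhds_iff.1 h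
  have hx := h (y := 1 + ε / 2) (by simp [abs_of_pos hε, hε])
  have ht := tangent_line_le hφ hd (x := 1 + ε / 2) (by linarith)
  rw [Real.norm_eq_abs, Real.norm_of_nonneg (sq_nonneg _)] at hx
  have := (le_abs_self _).trans hx
  have : 0 < -(deriv (deriv φ) 1) * (1 + ε / 2 - 1) ^ 2 := by
    apply mul_pos (by linarith); ring_nf; positivity
  nlinarith

/-- A convex function with a nondegenerate minimum at `1` of value `0`. -/
structure IsNormalizedDivergence (ψ : ℝ → ℝ) (κ : ℝ) : Prop where
  convexOn : ConvexOn ℝ (Set.Ioi 0) ψ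
  apply_one : ψ 1 = 0
  pos : 0 < κ
  isLittleO : (fun x => ψ x - κ * (x - 1) ^ 2) =o[𝓝 1] fun x => (x - 1) ^ 2

lemma IsDivergenceFunction.isNormalizedDivergence (hφ : IsDivergenceFunction φ)
    (hC : ContDiffOn ℝ 2 φ (Set.Ioi 0)) (h0 : deriv (deriv φ) 1 ≠ 0) :
    IsNormalizedDivergence (fun x => φ x - deriv φ 1 * (x - 1)) (deriv (deriv φ) 1 / 2) where
  convexOn := by
    have h : ConvexOn ℝ (Set.Ioi 0) fun x : ℝ => -deriv φ 1 * x + deriv φ 1 :=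
      (((LinearMap.mul ℝ ℝ (-deriv φ 1)).convexOn (convex_Ioi 0)).add_const (deriv φ 1))
    refine (hφ.1.add h).congr fun x _ => ?_
    simp only [Pi.add_apply]
    ring
  apply_one := by simp [hφ.2]
  pos := by linarith [deriv_deriv_one_pos hφ.1 hC h0]
  isLittleO := by simpa [hφ.2] using isLittleO_sub_taylor_two_at_one hC

/-- Near `1` the quadratic expansion gives the bound; away from `1`, convexity forces growth at
least linear in `|x - 1|`. Multiplied by `q`, these become `(p - q)² / q` and `|p - q|`, both at
least `(p - q)²` for entries in `(0, 1]`. -/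
lemma IsNormalizedDivergence.exists_lower_bound (h : IsNormalizedDivergence ψ κ) :
    ∃ c > 0, ∀ p q : ℝ, 0 < p → p ≤ 1 → 0 < q → q ≤ 1 → c * (p - q) ^ 2 ≤ q * ψ (p / q) := by
  have hκ := h.pos
  obtain ⟨ε, hε, hε'⟩ := Metric.eventually_nhds_iff.1 (h.isLittleO.def (c := κ / 2) (by linarith))
  -- `δ ≤ 1` lets the single constant `κ / 2 * δ` serve both regimes.
  obtain ⟨δ, hδ, hδ1, hδε⟩ : ∃ δ > 0, δ ≤ 1 ∧ δ < ε :=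
    ⟨min 1 (ε / 2), by positivity, min_le_left _ _, (min_le_right _ _).trans_lt (by linarith)⟩
  have hnear : ∀ x, |x - 1| ≤ δ → κ / 2 * (x - 1) ^ 2 ≤ ψ x := fun x hx => by
    have := hε' (y := x) (by rw [Real.dist_eq]; linarith)
    rw [Real.norm_eq_abs, Real.norm_of_nonneg (sq_nonneg _)] at this
    have := neg_abs_le (ψ x - κ * (x - 1) ^ 2)
    nlinarith
  have hfar : ∀ x, 0 < x → δ < |x - 1| → κ / 2 * δ * |x - 1| ≤ ψ x := fun x hx hxδ => by
    have hs0 : 0 < |x - 1| := hδ.trans hxδ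
    -- The chord from `1` to `x` is evaluated at distance exactly `δ` from `1`, where the quadratic
    -- bound still applies.
    set s := δ / |x - 1| with hs
    have hspos : 0 < s := by positivity
    have hs1 : s ≤ 1 := by rw [hs, div_le_one hs0]; exact hxδ.le
    have hsx : s * |x - 1| = δ := by rw [hs]; field_simp
    have hc := h.convexOn.2 (x := 1) (y := x) (by simp) hx (sub_nonneg.2 hs1) hspos.le (by ring)
    simp only [smul_eq_mul, h.apply_one, mul_zero, zero_add] at hc
    have e : (1 - s) * 1 + s * x - 1 = s * (x - 1) := by ring
    have hn := hnear ((1 - s) * 1 + s * x) (by rw [e, abs_mul, abs_of_pos hspos, hsx])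
    rw [e, mul_pow, ← sq_abs (x - 1), ← mul_pow, hsx] at hn
    have h3 : s * (κ / 2 * δ * |x - 1|) ≤ s * ψ x := by
      calc s * (κ / 2 * δ * |x - 1|) = κ / 2 * δ * (s * |x - 1|) := by ring
        _ = κ / 2 * δ ^ 2 := by rw [hsx]; ring
        _ ≤ _ := hn.trans hc
    exact le_of_mul_le_mul_left h3 hspos
  refine ⟨κ / 2 * δ, by positivity, fun p q hp hp1 hq hq1 => ?_⟩
  have e : p / q - 1 = (p - q) / q := by field_simp
  by_cases hx : |p / q - 1| ≤ δ
  · have h1 := mul_le_mul_of_nonneg_left (hnear _ hx) hq.le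
    have h2 : q * (κ / 2 * (p / q - 1) ^ 2) = κ / 2 * ((p - q) ^ 2 / q) := by
      rw [e]; field_simp
    rw [h2] at h1
    refine le_trans ?_ h1
    have h3 : (p - q) ^ 2 ≤ (p - q) ^ 2 / q := by
      rw [le_div_iff₀ hq]; nlinarith [sq_nonneg (p - q)]
    calc κ / 2 * δ * (p - q) ^ 2 ≤ κ / 2 * 1 * (p - q) ^ 2 := by gcongr
      _ = κ / 2 * (p - q) ^ 2 := by ring
      _ ≤ _ := by gcongr
  · have h1 := mul_le_mul_of_nonneg_left (hfar _ (by positivity) (not_le.1 hx)) hq.le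
    have h2 : q * (κ / 2 * δ * |p / q - 1|) = κ / 2 * δ * |p - q| := by
      rw [e, abs_div, abs_of_pos hq]; field_simp
    rw [h2] at h1
    refine le_trans ?_ h1
    have h3 : (p - q) ^ 2 ≤ |p - q| := by
      rw [← sq_abs]
      have : |p - q| ≤ 1 := abs_le.2 ⟨by linarith, by linarith⟩
      nlinarith [abs_nonneg (p - q)]
    gcongr

/-- The expansion of `ψ` gives `κ (p - q)² / q`; freezing the weight `1 / q` at `1 / a` costs a
factor that tends to zero. -/
lemma IsNormalizedDivergence.isLittleO_term (h : IsNormalizedDivergence ψ κ) {a : ℝ}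
    (ha : 0 < a) :
    (fun z : ℝ × ℝ => z.2 * ψ (z.1 / z.2) - κ * ((z.1 - z.2) ^ 2 / a))
      =o[𝓝 (a, a)] fun z => (z.1 - z.2) ^ 2 := by
  have hpos : ∀ᶠ z : ℝ × ℝ in 𝓝 (a, a), 0 < z.2 :=
    continuous_snd.continuousAt.eventually (lt_mem_nhds (b := a) ha)
  have hsnd : Tendsto (fun z : ℝ × ℝ => z.2) (𝓝 (a, a)) (𝓝 a) := continuous_snd.tendsto (a, a)
  have hinv : Tendsto (fun z : ℝ × ℝ => z.2⁻¹) (𝓝 (a, a)) (𝓝 a⁻¹) := hsnd.inv₀ ha.ne'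
  have hdiv : Tendsto (fun z : ℝ × ℝ => z.1 / z.2) (𝓝 (a, a)) (𝓝 1) := by
    have := (continuous_fst.tendsto (a, a)).div hsnd ha.ne'
    rwa [div_self ha.ne'] at this
  have h1 := (hsnd.isBigO_one ℝ).mul_isLittleO (h.isLittleO.comp_tendsto hdiv)
  have h2 : (fun z : ℝ × ℝ => 1 * ((z.1 / z.2) - 1) ^ 2) =O[𝓝 (a, a)]
      fun z => (z.1 - z.2) ^ 2 := by
    have := ((hinv.pow 2).isBigO_one ℝ).mul
      (Asymptotics.isBigO_refl (fun z : ℝ × ℝ => (z.1 - z.2) ^ 2) (𝓝 (a, a)))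
    refine (this.congr' ?_ ?_)
    · filter_upwards [hpos] with z hz
      field_simp
    · exact Eventually.of_forall fun z => one_mul _
  have h3 : (fun z : ℝ × ℝ => κ * (z.2⁻¹ - a⁻¹) * (z.1 - z.2) ^ 2) =o[𝓝 (a, a)]
      fun z => (z.1 - z.2) ^ 2 := by
    have h0 : Tendsto (fun z : ℝ × ℝ => κ * (z.2⁻¹ - a⁻¹)) (𝓝 (a, a)) (𝓝 0) := by
      simpa using (hinv.sub_const a⁻¹).const_mul κ
    simpa using ((Asymptotics.isLittleO_one_iff ℝ).2 h0).mul_isBigO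
      (Asymptotics.isBigO_refl (fun z : ℝ × ℝ => (z.1 - z.2) ^ 2) (𝓝 (a, a)))
  refine ((h1.trans_isBigO h2).add h3).congr' ?_ EventuallyEq.rfl
  filter_upwards [hpos] with z hz
  simp only [Function.comp]
  field_simp
  ring

end DivergenceFunction

/-! ### Approximate minimizers and linear least squares -/

section AsymptoticProjection

open Asymptotics

variable {α E F G : Type*} [NormedAddCommGroup E] [NormedSpace ℝ E]
  [NormedAddCommGroup F] [InnerProductSpace ℝ F] [NormedAddCommGroup G]

lemma isLittleO_norm_sub_sq_sub_norm_sq {l : Filter α} {u r : α → F} {x : α → G}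
    (hu : u =O[l] x) (hr : r =o[l] x) :
    (fun i => ‖u i - r i‖ ^ 2 - ‖u i‖ ^ 2) =o[l] fun i => ‖x i‖ ^ 2 := by
  have h1 : (fun i => inner ℝ (u i) (r i)) =o[l] fun i => ‖x i‖ ^ 2 := by
    have h := (hu.norm_norm.mul_isLittleO hr.norm_norm).congr_right
      (g₂ := fun i => ‖x i‖ ^ 2) fun i => (sq _).symm
    refine IsBigO.trans_isLittleO (IsBigO.of_bound 1 (Eventually.of_forall fun i => ?_)) h
    rw [one_mul, norm_mul, norm_norm, norm_norm]
    exact norm_inner_le_norm _ _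
  have h2 : (fun i => ‖r i‖ ^ 2) =o[l] fun i => ‖x i‖ ^ 2 := hr.norm_norm.pow two_pos
  refine ((h1.const_mul_left (-2)).add h2).congr_left fun i => ?_
  rw [norm_sub_sq_real]
  ring

variable [FiniteDimensional ℝ E] [NormedSpace ℝ G]

/-- If `T` makes `D P (p T)` at least as small as the parameter `θ₀ + L (S (P - p θ₀))` does,
where `D` is a quadratic form up to higher order terms and `L` is the least squares solution
operator of the linearised problem, then `T` is asymptotically that parameter. -/
theorem isLittleO_sub_leastSquares {l : Filter α} {θ₀ : E} {p : E → G} {J : E →L[ℝ] G}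
    {S : G →L[ℝ] F} {L : F →L[ℝ] E} {D : G → G → ℝ} {κ : ℝ} {P : α → G} {T : α → E}
    (hκ : 0 < κ) (hp : HasFDerivAt p J θ₀) (hA : Function.Injective (S ∘L J))
    (hL : ∀ z h, inner ℝ (z - S (J (L z))) (S (J h)) = 0)
    (hD : (fun z : G × G => D z.1 z.2 - κ * ‖S (z.1 - z.2)‖ ^ 2)
      =o[𝓝 (p θ₀, p θ₀)] fun z => ‖z.1 - z.2‖ ^ 2)
    (hP : Tendsto P l (𝓝 (p θ₀))) (hT : Tendsto T l (𝓝 θ₀))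
    (hO : (fun i => p (T i) - p θ₀) =O[l] fun i => P i - p θ₀)
    (hmin : ∀ᶠ i in l, D (P i) (p (T i)) ≤ D (P i) (p (θ₀ + L (S (P i - p θ₀))))) :
    (fun i => T i - θ₀ - L (S (P i - p θ₀))) =o[l] fun i => P i - p θ₀ := by
  obtain ⟨C, hC0, hC⟩ := LinearMap.exists_antilipschitzWith ((S ∘L J).toLinearMap)
    (LinearMap.ker_eq_bot.2 hA)
  have hCle : ∀ h, ‖h‖ ≤ C * ‖S (J h)‖ := fun h => by
    simpa [edist_dist, dist_eq_norm] using hC.le_mul_dist h 0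
  have hJ : (fun i => T i - θ₀) =O[l] fun i => J (T i - θ₀) := by
    refine IsBigO.of_bound (C * ‖S‖) (Eventually.of_forall fun i => (hCle _).trans ?_)
    rw [mul_assoc]
    exact mul_le_mul_of_nonneg_left (S.le_opNorm _) C.2
  -- By injectivity the differentiability remainder is negligible against `J (T - θ₀)`, which is
  -- therefore bounded by `p T - p θ₀`: the rate for `p T` passes to `T`.
  have hh : (fun i => T i - θ₀) =O[l] fun i => P i - p θ₀ := by
    have h1 := ((hasFDerivAt_iff_isLittleO.1 hp).comp_tendsto hT).trans_isBigO hJ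
    refine hJ.trans (h1.right_isBigO_add.trans (hO.congr_left fun i => ?_))
    simp
  have hstar : Tendsto (fun i => θ₀ + L (S (P i - p θ₀))) l (𝓝 θ₀) := by
    have : Tendsto (fun i => θ₀ + L (S (P i - p θ₀))) l (𝓝 (θ₀ + L (S (p θ₀ - p θ₀)))) :=
      tendsto_const_nhds.add ((L.continuous.comp S.continuous).continuousAt.tendsto.comp
        (hP.sub_const _))
    simpa using this
  have expand : ∀ U : α → E, Tendsto U l (𝓝 θ₀) →
      (fun i => U i - θ₀) =O[l] (fun i => P i - p θ₀) →
      (fun i => D (P i) (p (U i)) - κ * ‖S (P i - p θ₀) - S (J (U i - θ₀))‖ ^ 2)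
        =o[l] fun i => ‖P i - p θ₀‖ ^ 2 := by
    intro U hU hUO
    have hr : (fun i => p (U i) - p θ₀ - J (U i - θ₀)) =o[l] fun i => P i - p θ₀ :=
      ((hasFDerivAt_iff_isLittleO.1 hp).comp_tendsto hU).trans_isBigO hUO
    have hpU : Tendsto (fun i => p (U i)) l (𝓝 (p θ₀)) := hp.continuousAt.tendsto.comp hU
    have hPU : (fun i => P i - p (U i)) =O[l] fun i => P i - p θ₀ := by
      have h1 := (isBigO_refl (fun i => P i - p θ₀) l).sub
        (((hp.isBigO_sub).comp_tendsto hU).trans hUO)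
      exact h1.congr_left fun i => by simp
    have h1 := (hD.comp_tendsto (hP.prodMk_nhds hpU)).trans_isBigO (hPU.norm_norm.pow 2)
    have hu : (fun i => S (P i - p θ₀) - S (J (U i - θ₀))) =O[l] fun i => P i - p θ₀ :=
      (S.isBigO_comp _ _).sub (((S ∘L J).isBigO_comp _ _).trans hUO)
    have h2 := isLittleO_norm_sub_sq_sub_norm_sq hu ((S.isBigO_comp _ _).trans_isLittleO hr)
    refine (h1.add (h2.const_mul_left κ)).congr_left fun i => ?_
    simp only [Function.comp, map_sub]
    rw [show S (P i) - S (p θ₀) - (S (J (U i)) - S (J θ₀)) -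
      (S (p (U i)) - S (p θ₀) - (S (J (U i)) - S (J θ₀))) = S (P i) - S (p (U i)) by abel]
    ring
  have hstarO : (fun i => θ₀ + L (S (P i - p θ₀)) - θ₀) =O[l] fun i => P i - p θ₀ := by
    simpa using (L ∘L S).isBigO_comp (fun i => P i - p θ₀) l
  have h1 := expand T hT hh
  have h2 := expand _ hstar hstarO
  -- By Pythagoras `T` exceeds the least squares value of the linearised problem by `‖S (J e)‖²`.
  -- Since `T` does no worse for `D`, `κ` times this excess is at most the difference of the two
  -- expansion errors.
  have h3 : (fun i => ‖T i - θ₀ - L (S (P i - p θ₀))‖ ^ 2) =o[l] fun i => ‖P i - p θ₀‖ ^ 2 := by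
    refine (IsBigO.of_bound (C ^ 2 / κ) ?_).trans_isLittleO (h2.sub h1)
    filter_upwards [hmin] with i hi
    set x := P i - p θ₀
    set h := T i - θ₀
    set e := h - L (S x) with he
    have pyth : ‖S x - S (J h)‖ ^ 2 = ‖S x - S (J (L (S x)))‖ ^ 2 + ‖S (J e)‖ ^ 2 := by
      have e1 : S x - S (J h) = (S x - S (J (L (S x)))) - S (J e) := by
        simp only [he, map_sub]; abel
      rw [e1, norm_sub_sq_real, hL]
      ring
    rw [norm_pow, norm_norm, Real.norm_eq_abs]
    have e2 : θ₀ + L (S x) - θ₀ = L (S x) := by abel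
    rw [e2]
    refine le_trans ?_ (mul_le_mul_of_nonneg_left (le_abs_self _) (by positivity))
    have h4 : ‖e‖ ^ 2 ≤ C ^ 2 * ‖S (J e)‖ ^ 2 := by
      rw [← mul_pow]; exact pow_le_pow_left₀ (norm_nonneg _) (hCle e) 2
    refine h4.trans ?_
    rw [div_mul_eq_mul_div, mul_div_assoc]
    refine mul_le_mul_of_nonneg_left ?_ (by positivity)
    rw [le_div_iff₀ hκ, pyth]
    linarith
  exact (h3.of_pow two_ne_zero).of_norm_norm

end AsymptoticProjection

/-! ### Quadratic behaviour of the divergence of vectors -/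

section RealDivergence

variable {ι : Type*} {ψ : ℝ → ℝ} {κ : ℝ}

/-- The `φ`-divergence of two vectors with positive entries. -/
noncomputable def realDivergence [Fintype ι] (ψ : ℝ → ℝ) (p q : ι → ℝ) : ℝ := ∑ y, q y * ψ (p y / q y)

/-- The linear map that divides each coordinate by the square root of the weight `a`. -/
noncomputable def invSqrtScale (a : ι → ℝ) : (ι → ℝ) →L[ℝ] EuclideanSpace ℝ ι :=
  (EuclideanSpace.equiv ι ℝ).symm.toContinuousLinearMap ∘L
    ContinuousLinearMap.pi fun y => (Real.sqrt (a y))⁻¹ • ContinuousLinearMap.proj y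

lemma invSqrtScale_apply (a x : ι → ℝ) (y : ι) :
    invSqrtScale a x y = (Real.sqrt (a y))⁻¹ * x y := rfl

variable [Fintype ι]

lemma norm_invSqrtScale_sq {a : ι → ℝ} (ha : ∀ y, 0 < a y) (x : ι → ℝ) :
    ‖invSqrtScale a x‖ ^ 2 = ∑ y, x y ^ 2 / a y := by
  rw [EuclideanSpace.real_norm_sq_eq]
  refine Finset.sum_congr rfl fun y _ => ?_
  rw [invSqrtScale_apply, mul_pow, inv_pow, Real.sq_sqrt (ha y).le]
  field_simp

open Asymptotics in
lemma IsNormalizedDivergence.isLittleO_realDivergence (hψ : IsNormalizedDivergence ψ κ)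
    {a : ι → ℝ} (ha : ∀ y, 0 < a y) :
    (fun z : (ι → ℝ) × (ι → ℝ) => realDivergence ψ z.1 z.2 -
      κ * ‖invSqrtScale a (z.1 - z.2)‖ ^ 2) =o[𝓝 (a, a)] fun z => ‖z.1 - z.2‖ ^ 2 := by
  have h : ∀ y ∈ Finset.univ, (fun z : (ι → ℝ) × (ι → ℝ) => z.2 y * ψ (z.1 y / z.2 y) -
      κ * ((z.1 y - z.2 y) ^ 2 / a y)) =o[𝓝 (a, a)] fun z => ‖z.1 - z.2‖ ^ 2 := by
    intro y _
    have ht : Tendsto (fun z : (ι → ℝ) × (ι → ℝ) => (z.1 y, z.2 y)) (𝓝 (a, a))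
        (𝓝 (a y, a y)) := by
      have : Continuous fun z : (ι → ℝ) × (ι → ℝ) => (z.1 y, z.2 y) := by fun_prop
      exact this.tendsto (a, a)
    refine ((hψ.isLittleO_term (ha y)).comp_tendsto ht).trans_isBigO
      (IsBigO.of_bound 1 (Eventually.of_forall fun z => ?_))
    simp only [Function.comp, norm_pow, norm_norm, one_mul]
    exact pow_le_pow_left₀ (norm_nonneg _) (norm_le_pi_norm (z.1 - z.2) y) 2
  refine (IsLittleO.sum h).congr_left fun z => ?_
  rw [norm_invSqrtScale_sq ha, realDivergence, Finset.mul_sum, ← Finset.sum_sub_distrib,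
    Finset.sum_apply]
  rfl

lemma IsNormalizedDivergence.exists_realDivergence_lower_bound
    (hψ : IsNormalizedDivergence ψ κ) :
    ∃ c > 0, ∀ p q : ι → ℝ, (∀ y, 0 < p y ∧ p y ≤ 1) → (∀ y, 0 < q y ∧ q y ≤ 1) →
      c * ‖p - q‖ ^ 2 ≤ realDivergence ψ p q := by
  obtain ⟨c, hc, h⟩ := hψ.exists_lower_bound
  refine ⟨c, hc, fun p q hp hq => ?_⟩
  have hterm : ∀ y, c * (p y - q y) ^ 2 ≤ q y * ψ (p y / q y) := fun y =>
    h _ _ (hp y).1 (hp y).2 (hq y).1 (hq y).2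
  have hnn : ∀ y, 0 ≤ q y * ψ (p y / q y) := fun y => le_trans (by positivity) (hterm y)
  have hD : 0 ≤ realDivergence ψ p q := Finset.sum_nonneg fun y _ => hnn y
  have h1 : ‖p - q‖ ≤ Real.sqrt (realDivergence ψ p q / c) := by
    refine (pi_norm_le_iff_of_nonneg (Real.sqrt_nonneg _)).2 fun y => ?_
    refine Real.le_sqrt_of_sq_le ?_
    rw [le_div_iff₀ hc, Pi.sub_apply, Real.norm_eq_abs, sq_abs, mul_comm]
    exact (hterm y).trans (Finset.single_le_sum (fun y _ => hnn y) (Finset.mem_univ y))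
  have h2 := pow_le_pow_left₀ (norm_nonneg _) h1 2
  rw [Real.sq_sqrt (by positivity), le_div_iff₀ hc] at h2
  linarith

end RealDivergence

/-! ### Existence and linear approximation of minimizers -/

section MinimumDivergence

open Asymptotics

variable {ι E : Type*} [Fintype ι]
  {ψ : ℝ → ℝ} {κ : ℝ} {p : E → ι → ℝ} {Θ : Set E} {θ₀ : E}

lemma le_one_of_sum_eq_one {q : ι → ℝ} (hq : ∀ y, 0 < q y) (hs : ∑ y, q y = 1) (y : ι) :
    q y ≤ 1 := by
  rw [← hs]
  exact Finset.single_le_sum (fun y _ => (hq y).le) (Finset.mem_univ y)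

lemma eventually_forall_pos {a : ι → ℝ} (ha : ∀ y, 0 < a y) : ∀ᶠ P in 𝓝 a, ∀ y, 0 < P y :=
  eventually_all.2 fun y => (continuous_apply y).continuousAt.eventually (lt_mem_nhds (ha y))

/-- The divergence from `P` to `p θ₀` is `O(‖P - p θ₀‖²)`, and the global lower bound turns this
into a bound on `‖P - p θ‖`. No closeness of `θ` to `θ₀` is needed, so this yields consistency. -/
lemma IsNormalizedDivergence.exists_norm_sub_le (hψ : IsNormalizedDivergence ψ κ)
    (hpos : ∀ θ y, 0 < p θ y) (hsum : ∀ θ, ∑ y, p θ y = 1) (θ₀ : E) :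
    ∃ C > 0, ∀ᶠ P in 𝓝 (p θ₀), ∑ y, P y = 1 → ∀ θ,
      realDivergence ψ P (p θ) ≤ realDivergence ψ P (p θ₀) →
        ‖p θ - p θ₀‖ ≤ C * ‖P - p θ₀‖ := by
  obtain ⟨c, hc, hlow⟩ := hψ.exists_realDivergence_lower_bound (ι := ι)
  have ht : Tendsto (fun P : ι → ℝ => (P, p θ₀)) (𝓝 (p θ₀)) (𝓝 (p θ₀, p θ₀)) :=
    tendsto_id.prodMk_nhds tendsto_const_nhds
  have h1 := (hψ.isLittleO_realDivergence (hpos θ₀)).comp_tendsto ht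
  have h2 : (fun P : ι → ℝ => κ * ‖invSqrtScale (p θ₀) (P - p θ₀)‖ ^ 2) =O[𝓝 (p θ₀)]
      fun P => ‖P - p θ₀‖ ^ 2 :=
    (((invSqrtScale (p θ₀)).isBigO_comp (fun P => P - p θ₀) _).norm_norm.pow 2).const_mul_left κ
  have h3 : (fun P : ι → ℝ => realDivergence ψ P (p θ₀)) =O[𝓝 (p θ₀)]
      fun P => ‖P - p θ₀‖ ^ 2 := (h1.isBigO.add h2).congr_left fun P => by simp
  obtain ⟨B, hB, hle⟩ := h3.exists_pos
  refine ⟨1 + Real.sqrt (B / c), by positivity, ?_⟩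
  filter_upwards [hle.bound, eventually_forall_pos (hpos θ₀)] with P hP hPpos hPs θ hθ
  rw [norm_pow, norm_norm] at hP
  have h4 := (hlow P (p θ) (fun y => ⟨hPpos y, le_one_of_sum_eq_one hPpos hPs y⟩)
    (fun y => ⟨hpos θ y, le_one_of_sum_eq_one (hpos θ) (hsum θ) y⟩)).trans
      (hθ.trans ((le_abs_self _).trans hP))
  have h5 : ‖P - p θ‖ ≤ Real.sqrt (B / c) * ‖P - p θ₀‖ := by
    refine abs_le_of_sq_le_sq' ?_ (by positivity) |>.2
    rw [mul_pow, Real.sq_sqrt (by positivity), div_mul_eq_mul_div, le_div_iff₀ hc]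
    linarith
  calc ‖p θ - p θ₀‖ = ‖(P - p θ₀) - (P - p θ)‖ := by congr 1; abel
    _ ≤ ‖P - p θ₀‖ + ‖P - p θ‖ := norm_sub_le _ _
    _ ≤ _ := by linarith

variable [NormedAddCommGroup E] [NormedSpace ℝ E] [FiniteDimensional ℝ E]

/-- A point of `Θ` at least as good as `θ₀` has `p θ` near `p θ₀`, hence lies in a fixed compact
ball inside `Θ`; a minimizer over that ball is one over `Θ`. -/
lemma IsNormalizedDivergence.eventually_exists_isMinOn (hψ : IsNormalizedDivergence ψ κ)
    (hψc : ContinuousOn ψ (Set.Ioi 0)) (hpos : ∀ θ y, 0 < p θ y) (hsum : ∀ θ, ∑ y, p θ y = 1)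
    (hcont : Continuous p) (hθ₀ : θ₀ ∈ interior Θ)
    (hinv : ∀ ε > 0, ∃ δ > 0, ∀ θ ∈ Θ, dist (p θ) (p θ₀) < δ → dist θ θ₀ < ε) :
    ∀ᶠ P in 𝓝 (p θ₀), ∑ y, P y = 1 →
      ∃ θ ∈ Θ, IsMinOn (fun θ' => realDivergence ψ P (p θ')) Θ θ := by
  have := FiniteDimensional.proper_real E
  obtain ⟨C, hC, hev⟩ := hψ.exists_norm_sub_le hpos hsum θ₀
  obtain ⟨r, hr, hrΘ⟩ := Metric.nhds_basis_closedBall.mem_iff.1 (mem_interior_iff_mem_nhds.1 hθ₀)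
  obtain ⟨δ, hδ, hδr⟩ := hinv r hr
  filter_upwards [hev, eventually_forall_pos (hpos θ₀), Metric.ball_mem_nhds _ (div_pos hδ hC)]
    with P hP hPpos hPδ hPs
  have hDc : Continuous fun θ' => realDivergence ψ P (p θ') := by
    refine continuous_finsetSum _ fun y _ => ?_
    have hy : Continuous fun θ => p θ y := (continuous_apply y).comp hcont
    exact hy.mul (hψc.comp_continuous (continuous_const.div hy fun θ => (hpos θ y).ne')
      fun θ => div_pos (hPpos y) (hpos θ y))
  obtain ⟨θ₁, hθ₁, hmin⟩ := (isCompact_closedBall θ₀ r).exists_isMinOn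
    ⟨θ₀, Metric.mem_closedBall_self hr.le⟩ hDc.continuousOn
  refine ⟨θ₁, hrΘ hθ₁, fun θ hθ => ?_⟩
  have h0 := isMinOn_iff.1 hmin θ₀ (Metric.mem_closedBall_self hr.le)
  rcases le_total (realDivergence ψ P (p θ₀)) (realDivergence ψ P (p θ)) with h | h
  · exact h0.trans h
  · refine hmin (Metric.ball_subset_closedBall (hδr θ hθ ?_))
    rw [dist_eq_norm]
    refine (hP hPs θ h).trans_lt ?_
    rw [Metric.mem_ball, dist_eq_norm, lt_div_iff₀ hC] at hPδ
    linarith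

lemma IsNormalizedDivergence.eventually_norm_sub_leastSquares_le
    (hψ : IsNormalizedDivergence ψ κ)
    (hpos : ∀ θ y, 0 < p θ y) (hsum : ∀ θ, ∑ y, p θ y = 1) (hθ₀ : θ₀ ∈ interior Θ)
    (hinv : ∀ ε > 0, ∃ δ > 0, ∀ θ ∈ Θ, dist (p θ) (p θ₀) < δ → dist θ θ₀ < ε)
    {J : E →L[ℝ] ι → ℝ} (hJ : HasFDerivAt p J θ₀) {L : EuclideanSpace ℝ ι →L[ℝ] E}
    (hA : Function.Injective (invSqrtScale (p θ₀) ∘L J))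
    (hL : ∀ z h, inner ℝ (z - invSqrtScale (p θ₀) (J (L z))) (invSqrtScale (p θ₀) (J h)) = 0)
    {ε : ℝ} (hε : 0 < ε) :
    ∀ᶠ P in 𝓝 (p θ₀), ∑ y, P y = 1 → ∀ θ ∈ Θ,
      IsMinOn (fun θ' => realDivergence ψ P (p θ')) Θ θ →
        ‖θ - θ₀ - L (invSqrtScale (p θ₀) (P - p θ₀))‖ ≤ ε * ‖P - p θ₀‖ := by
  set S := invSqrtScale (p θ₀)
  -- A filter on pairs (data, minimizer) replaces the choice of a minimizer for each `P`, and makes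
  -- the estimate uniform over all minimizers.
  set l : Filter ((ι → ℝ) × E) := comap Prod.fst (𝓝 (p θ₀)) ⊓
    𝓟 {z | ∑ y, z.1 y = 1 ∧ z.2 ∈ Θ ∧ IsMinOn (fun θ' => realDivergence ψ z.1 (p θ')) Θ z.2}
    with hl
  have hmem : ∀ᶠ z in l, ∑ y, z.1 y = 1 ∧ z.2 ∈ Θ ∧
      IsMinOn (fun θ' => realDivergence ψ z.1 (p θ')) Θ z.2 :=
    mem_inf_of_right (mem_principal_self _)
  have hP : Tendsto Prod.fst l (𝓝 (p θ₀)) := tendsto_comap.mono_left inf_le_left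
  obtain ⟨C, hC, hev⟩ := hψ.exists_norm_sub_le hpos hsum θ₀
  have hO : (fun z : (ι → ℝ) × E => p z.2 - p θ₀) =O[l] fun z => z.1 - p θ₀ := by
    refine IsBigO.of_bound C ?_
    filter_upwards [hP.eventually hev, hmem] with z h1 h2
    exact h1 h2.1 _ (h2.2.2 (interior_subset hθ₀))
  have hpT : Tendsto (fun z : (ι → ℝ) × E => p z.2) l (𝓝 (p θ₀)) := by
    have h0 : Tendsto (fun z : (ι → ℝ) × E => z.1 - p θ₀) l (𝓝 0) := by
      simpa using hP.sub_const (p θ₀)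
    simpa using (hO.trans_tendsto h0).add_const (p θ₀)
  have hT : Tendsto Prod.snd l (𝓝 θ₀) := by
    refine Metric.tendsto_nhds.2 fun η hη => ?_
    obtain ⟨δ, hδ, h⟩ := hinv η hη
    filter_upwards [hmem, hpT (Metric.ball_mem_nhds _ hδ)] with z h1 h2
    exact h _ h1.2.1 h2
  have hstar : Tendsto (fun z : (ι → ℝ) × E => θ₀ + L (S (z.1 - p θ₀))) l (𝓝 θ₀) := by
    have hc : Continuous fun P : ι → ℝ => θ₀ + L (S (P - p θ₀)) := by fun_prop
    simpa [Function.comp_def] using (hc.tendsto (p θ₀)).comp hP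
  -- Interiority of `θ₀` puts the least squares candidate in `Θ`, so a minimizer may be compared
  -- with it.
  have key := isLittleO_sub_leastSquares hψ.pos hJ hA hL
    (hψ.isLittleO_realDivergence (hpos θ₀)) hP hT hO (by
      filter_upwards [hmem, hstar (mem_interior_iff_mem_nhds.1 hθ₀)] with z h1 h2
      exact h1.2.2 h2)
  have := eventually_comap.1 (eventually_inf_principal.1 (hl ▸ key.def hε))
  filter_upwards [this] with P hP' hPs θ hθ hmin
  exact hP' (P, θ) rfl ⟨hPs, hθ, hmin⟩

end MinimumDivergence

/-! ### Model probabilities, Fisher information and the least squares operator -/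

namespace BinaryLCM

variable {k m t u : ℕ} (M : BinaryLCM k m t u)

lemma itemProb_pos (θ : LCMParam t u) (j : Fin m) (i : Fin k) : 0 < M.itemProb θ j i := by
  unfold itemProb; positivity

lemma itemProb_lt_one (θ : LCMParam t u) (j : Fin m) (i : Fin k) : M.itemProb θ j i < 1 := by
  unfold itemProb
  rw [div_lt_one (by positivity)]
  linarith

lemma answerProb_pos (θ : LCMParam t u) (y : AnswerPattern k) (j : Fin m) :
    0 < ∏ i, (if y i = true then M.itemProb θ j i else 1 - M.itemProb θ j i) := by
  refine Finset.prod_pos fun i _ => ?_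
  split_ifs
  · exact M.itemProb_pos θ j i
  · linarith [M.itemProb_lt_one θ j i]

lemma sum_answerProb (θ : LCMParam t u) (j : Fin m) :
    ∑ y : AnswerPattern k,
      ∏ i, (if y i = true then M.itemProb θ j i else 1 - M.itemProb θ j i) = 1 := by
  have h := Fintype.prod_sum (ι := Fin k) (κ := fun _ => Bool)
    fun i b => if b = true then M.itemProb θ j i else 1 - M.itemProb θ j i
  rw [← h]
  simp

section Nonempty

variable [Nonempty (Fin m)]

lemma sum_exp_classPredictor_pos (θ : LCMParam t u) :
    0 < ∑ h, Real.exp (M.classPredictor θ h) :=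
  Finset.sum_pos (fun _ _ => Real.exp_pos _) Finset.univ_nonempty

lemma classWeight_pos (θ : LCMParam t u) (j : Fin m) : 0 < M.classWeight θ j :=
  div_pos (Real.exp_pos _) (M.sum_exp_classPredictor_pos θ)

lemma sum_classWeight (θ : LCMParam t u) : ∑ j, M.classWeight θ j = 1 := by
  unfold classWeight
  rw [← Finset.sum_div, div_self (M.sum_exp_classPredictor_pos θ).ne']

lemma manifestProb_pos (θ : LCMParam t u) (y : AnswerPattern k) : 0 < M.manifestProb θ y :=
  Finset.sum_pos (fun j _ => mul_pos (M.classWeight_pos θ j) (M.answerProb_pos θ y j))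
    Finset.univ_nonempty

lemma sum_manifestProb (θ : LCMParam t u) : ∑ y, M.manifestProb θ y = 1 := by
  unfold manifestProb
  rw [Finset.sum_comm]
  simp_rw [← Finset.mul_sum, M.sum_answerProb, mul_one]
  exact M.sum_classWeight θ

lemma continuous_manifestProb : Continuous M.manifestProb := by
  have h1 : ∀ j i, Continuous fun θ => M.itemProb θ j i := fun j i => by
    have : Continuous fun θ => Real.exp (M.itemPredictor θ j i) := by
      unfold itemPredictor; fun_prop
    exact this.div (continuous_const.add this) fun θ => by positivity
  have h2 : ∀ j, Continuous fun θ => M.classWeight θ j := fun j => by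
    have : ∀ j, Continuous fun θ => Real.exp (M.classPredictor θ j) := fun j => by
      unfold classPredictor; fun_prop
    exact (this j).div (continuous_finsetSum _ fun h _ => this h)
      fun θ => (M.sum_exp_classPredictor_pos θ).ne'
  refine continuous_pi fun y => continuous_finsetSum _ fun j _ => (h2 j).mul ?_
  refine continuous_finsetProd _ fun i _ => ?_
  split_ifs
  · exact h1 j i
  · exact continuous_const.sub (h1 j i)

end Nonempty

variable {M} {θ : LCMParam t u}

lemma jacobian_apply (hd : DifferentiableAt ℝ M.manifestProb θ) (y : AnswerPattern k)
    (s : Fin t ⊕ Fin u) :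
    M.jacobian θ y s = fderiv ℝ M.manifestProb θ (EuclideanSpace.single s 1) y := by
  simp only [jacobian, Matrix.of_apply]
  rw [((hasFDerivAt_pi'.1 hd.hasFDerivAt) y).fderiv]
  rfl

lemma jacobian_mulVec (hd : DifferentiableAt ℝ M.manifestProb θ) (h : LCMParam t u) :
    M.jacobian θ *ᵥ h = fderiv ℝ M.manifestProb θ h := by
  have hh : h = ∑ s, h s • EuclideanSpace.single s (1 : ℝ) := by
    ext s
    cases s <;> simp [Pi.single_apply]
  ext y
  conv_rhs => rw [hh, map_sum]
  simp only [Matrix.mulVec, dotProduct, jacobian_apply hd, map_smul, Finset.sum_apply,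
    Pi.smul_apply, smul_eq_mul]
  exact Finset.sum_congr rfl fun s _ => mul_comm _ _

lemma scaledJacobian_mulVec (hd : DifferentiableAt ℝ M.manifestProb θ) (h : LCMParam t u) :
    WithLp.toLp 2 (M.scaledJacobian θ *ᵥ h) =
      invSqrtScale (M.manifestProb θ) (fderiv ℝ M.manifestProb θ h) := by
  ext y
  rw [invSqrtScale_apply, scaledJacobian, ← Matrix.mulVec_mulVec, jacobian_mulVec hd]
  exact Matrix.mulVec_diagonal _ _ _

lemma mulVec_scaledJacobian_injective (hpos : ∀ y, 0 < M.manifestProb θ y)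
    (hrank : (M.jacobian θ).rank = t + u) :
    Function.Injective (M.scaledJacobian θ).mulVec := by
  have hJ : Function.Injective (M.jacobian θ).mulVec := by
    rw [Matrix.mulVec_injective_iff, linearIndependent_iff_card_eq_finrank_span]
    rw [Set.finrank, ← Matrix.rank_eq_finrank_span_cols, hrank]
    simp
  intro v w hvw
  refine hJ (funext fun y => ?_)
  have := congrFun hvw y
  simp only [scaledJacobian, ← Matrix.mulVec_mulVec, Matrix.mulVec_diagonal] at this
  exact mul_left_cancel₀ (inv_ne_zero (Real.sqrt_pos.2 (hpos y)).ne') this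

lemma posDef_transpose_mul_scaledJacobian (hpos : ∀ y, 0 < M.manifestProb θ y)
    (hrank : (M.jacobian θ).rank = t + u) :
    ((M.scaledJacobian θ)ᵀ * M.scaledJacobian θ).PosDef := by
  rw [← Matrix.conjTranspose_eq_transpose_of_trivial]
  exact Matrix.PosDef.conjTranspose_mul_self _ (mulVec_scaledJacobian_injective hpos hrank)

lemma transpose_mul_scaledJacobian_eq_fisherInformation (hpos : ∀ y, 0 < M.manifestProb θ y)
    (hd : DifferentiableAt ℝ M.manifestProb θ) :
    (M.scaledJacobian θ)ᵀ * M.scaledJacobian θ = M.fisherInformation θ := by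
  ext r s
  simp only [Matrix.mul_apply, Matrix.transpose_apply, fisherInformation, Matrix.of_apply]
  refine Finset.sum_congr rfl fun y _ => ?_
  have hs : ∀ s, M.score θ y s = (M.manifestProb θ y)⁻¹ * M.jacobian θ y s := fun s => by
    have hy : HasFDerivAt (fun θ' => M.manifestProb θ' y)
      (fderiv ℝ (fun θ' => M.manifestProb θ' y) θ) θ :=
        ((hasFDerivAt_pi'.1 hd.hasFDerivAt) y).differentiableAt.hasFDerivAt
    simp [score, (hy.log (hpos y).ne').fderiv, jacobian]
  have hA : ∀ s, M.scaledJacobian θ y s =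
      (Real.sqrt (M.manifestProb θ y))⁻¹ * M.jacobian θ y s := fun s => by
    simp [scaledJacobian, Matrix.diagonal_mul]
  rw [hs, hs, hA, hA]
  have hq : (Real.sqrt (M.manifestProb θ y))⁻¹ * (Real.sqrt (M.manifestProb θ y))⁻¹ =
      (M.manifestProb θ y)⁻¹ := by
    rw [← mul_inv, Real.mul_self_sqrt (hpos y).le]
  have h0 := (hpos y).ne'
  calc _ = ((Real.sqrt (M.manifestProb θ y))⁻¹ * (Real.sqrt (M.manifestProb θ y))⁻¹) *
        (M.jacobian θ y r * M.jacobian θ y s) := by ring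
    _ = _ := by rw [hq]; field_simp

/-- The total probability is constantly `1`. This is what centers the limit law. -/
lemma sum_fderiv_manifestProb [Nonempty (Fin m)] (hd : DifferentiableAt ℝ M.manifestProb θ)
    (h : LCMParam t u) : ∑ y, fderiv ℝ M.manifestProb θ h y = 0 := by
  have h1 : HasFDerivAt (fun θ' => ∑ y, M.manifestProb θ' y)
      (∑ y, (ContinuousLinearMap.proj y).comp (fderiv ℝ M.manifestProb θ)) θ :=
    HasFDerivAt.fun_sum fun y _ => hasFDerivAt_pi'.1 hd.hasFDerivAt y
  simp_rw [M.sum_manifestProb] at h1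
  have h2 := h1.unique (hasFDerivAt_const 1 θ)
  simpa using congrArg (fun f => f h) h2

/-- The least squares solution operator `(AᵀA)⁻¹Aᵀ` of `A = scaledJacobian θ`. -/
noncomputable def leastSquares (M : BinaryLCM k m t u) (θ : LCMParam t u) :
    EuclideanSpace ℝ (AnswerPattern k) →L[ℝ] LCMParam t u :=
  (Matrix.toLpLin 2 2 (((M.scaledJacobian θ)ᵀ * M.scaledJacobian θ)⁻¹ *
    (M.scaledJacobian θ)ᵀ)).toContinuousLinearMap

lemma leastSquares_apply (z : EuclideanSpace ℝ (AnswerPattern k)) :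
    (M.leastSquares θ z : Fin t ⊕ Fin u → ℝ) =
      (((M.scaledJacobian θ)ᵀ * M.scaledJacobian θ)⁻¹ * (M.scaledJacobian θ)ᵀ) *ᵥ z := rfl

/-- These are the normal equations `Aᵀ(z - A(AᵀA)⁻¹Aᵀz) = 0`. -/
lemma inner_sub_leastSquares (hpos : ∀ y, 0 < M.manifestProb θ y)
    (hrank : (M.jacobian θ).rank = t + u) (hd : DifferentiableAt ℝ M.manifestProb θ)
    (z : EuclideanSpace ℝ (AnswerPattern k)) (h : LCMParam t u) :
    inner ℝ (z - invSqrtScale (M.manifestProb θ) (fderiv ℝ M.manifestProb θ (M.leastSquares θ z)))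
      (invSqrtScale (M.manifestProb θ) (fderiv ℝ M.manifestProb θ h)) = 0 := by
  rw [← scaledJacobian_mulVec hd, ← scaledJacobian_mulVec hd, leastSquares_apply]
  have hdet := (posDef_transpose_mul_scaledJacobian hpos hrank).isUnit
  rw [Matrix.isUnit_iff_isUnit_det] at hdet
  rw [EuclideanSpace.inner_eq_star_dotProduct]
  simp only [star_trivial]
  rw [dotProduct_comm, Matrix.dotProduct_mulVec, ← Matrix.mulVec_transpose]
  rw [WithLp.ofLp_sub, Matrix.mulVec_sub, Matrix.mulVec_mulVec, Matrix.mulVec_mulVec,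
    ← Matrix.mul_assoc, Matrix.mul_nonsing_inv _ hdet, Matrix.one_mul, sub_self,
    zero_dotProduct]

/-- The scaled vector is `√p`, and `Aᵀ√p` consists of the column sums of the Jacobian, which vanish.
-/
lemma leastSquares_invSqrtScale_self [Nonempty (Fin m)] (hd : DifferentiableAt ℝ M.manifestProb θ) :
    M.leastSquares θ (invSqrtScale (M.manifestProb θ) (M.manifestProb θ)) = 0 := by
  have h : (M.scaledJacobian θ)ᵀ *ᵥ (invSqrtScale (M.manifestProb θ) (M.manifestProb θ)) = 0 := by
    ext s
    have hs := sum_fderiv_manifestProb hd (EuclideanSpace.single s 1)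
    simp_rw [← jacobian_apply hd] at hs
    rw [Pi.zero_apply, ← hs]
    refine Finset.sum_congr rfl fun y _ => ?_
    have h0 := (Real.sqrt_pos.2 (M.manifestProb_pos θ y)).ne'
    have h1 := Real.mul_self_sqrt (M.manifestProb_pos θ y).le
    have h2 : M.scaledJacobian θ y s = (Real.sqrt (M.manifestProb θ y))⁻¹ * M.jacobian θ y s :=
      Matrix.diagonal_mul _ _ _ _
    change M.scaledJacobian θ y s * _ = _
    rw [invSqrtScale_apply, h2]
    field_simp
    rw [sq, h1]
    ring
  apply WithLp.ofLp_injective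
  rw [leastSquares_apply, ← Matrix.mulVec_mulVec, h, Matrix.mulVec_zero]
  rfl

/-- The weights `p_y` cancel the squared scaling `1 / p_y`, leaving `‖Bᵀx‖²` for `B = (AᵀA)⁻¹Aᵀ`,
and `B Bᵀ = (AᵀA)⁻¹`. -/
lemma sum_inner_leastSquares_sq (hpos : ∀ y, 0 < M.manifestProb θ y)
    (hrank : (M.jacobian θ).rank = t + u) (x : LCMParam t u) :
    ∑ y, M.manifestProb θ y * inner ℝ
      (M.leastSquares θ (invSqrtScale (M.manifestProb θ) (Pi.single y 1))) x ^ 2 =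
        x ⬝ᵥ ((M.scaledJacobian θ)ᵀ * M.scaledJacobian θ)⁻¹ *ᵥ x := by
  have hpd := posDef_transpose_mul_scaledJacobian hpos hrank
  have hdet := hpd.isUnit
  rw [Matrix.isUnit_iff_isUnit_det] at hdet
  set A := M.scaledJacobian θ with hA
  set B := (Aᵀ * A)⁻¹ * Aᵀ with hB
  have hsymm : ((Aᵀ * A)⁻¹)ᵀ = (Aᵀ * A)⁻¹ := by
    rw [Matrix.transpose_nonsing_inv, Matrix.transpose_mul, Matrix.transpose_transpose]
  have hBB : B * Bᵀ = (Aᵀ * A)⁻¹ := by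
    rw [hB, Matrix.transpose_mul, hsymm, Matrix.transpose_transpose, Matrix.mul_assoc,
      ← Matrix.mul_assoc Aᵀ, Matrix.mul_nonsing_inv _ hdet, Matrix.mul_one]
  rw [← hBB, ← Matrix.mulVec_mulVec, Matrix.dotProduct_mulVec, ← Matrix.mulVec_transpose]
  refine Finset.sum_congr rfl fun y _ => ?_
  have h1 : invSqrtScale (M.manifestProb θ) (Pi.single y 1) =
      EuclideanSpace.single y (Real.sqrt (M.manifestProb θ y))⁻¹ := by
    ext z
    rw [invSqrtScale_apply]
    by_cases hz : z = y
    · subst hz; simp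
    · simp [hz]
  have h2 : inner ℝ (M.leastSquares θ (invSqrtScale (M.manifestProb θ) (Pi.single y 1))) x =
      (Real.sqrt (M.manifestProb θ y))⁻¹ * (Bᵀ *ᵥ x) y := by
    rw [h1, EuclideanSpace.inner_eq_star_dotProduct, leastSquares_apply, star_trivial, ← hA, ← hB,
      Matrix.dotProduct_mulVec, ← Matrix.mulVec_transpose]
    simp [mul_comm]
  rw [h2, mul_pow, inv_pow, Real.sq_sqrt (hpos y).le, mul_inv_cancel_left₀ (hpos y).ne', sq]

end BinaryLCM

/-! ### Central limit theorem and negligible remainders -/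

section LimitTheorems

variable {Ω : Type*} [MeasurableSpace Ω] {μ : Measure Ω} [IsProbabilityMeasure μ]

/-- The multivariate central limit theorem for centered square integrable random vectors. -/
theorem tendstoInDistribution_inv_sqrt_smul_sum {κ : Type*} [Fintype κ] [DecidableEq κ]
    {X : ℕ → Ω → EuclideanSpace ℝ κ} {S : Matrix κ κ ℝ} (hS : S.PosSemidef)
    (hX : MemLp (X 0) 2 μ) (hmean : ∀ x, ∫ ω, inner ℝ (X 0 ω) x ∂μ = 0)
    (hcov : ∀ x : EuclideanSpace ℝ κ, ∫ ω, inner ℝ (X 0 ω) x ^ 2 ∂μ = x ⬝ᵥ S *ᵥ x)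
    (hindep : iIndepFun X μ) (hident : ∀ i, IdentDistrib (X i) (X 0) μ μ) :
    TendstoInDistribution (fun (n : ℕ) ω => (Real.sqrt n)⁻¹ • ∑ k ∈ Finset.range n, X k ω) atTop
      (fun x : EuclideanSpace ℝ κ => x) (fun _ => μ) (multivariateGaussian 0 S) := by
  have hm : ∀ i, AEMeasurable (X i) μ := fun i => (hident i).aemeasurable_fst
  have hW : ∀ n : ℕ, AEMeasurable (fun ω => (Real.sqrt n)⁻¹ • ∑ k ∈ Finset.range n, X k ω) μ :=
    fun n => (Finset.aemeasurable_fun_sum (Finset.range n) fun k _ => hm k).const_smul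
      (Real.sqrt n)⁻¹
  refine ⟨hW, by fun_prop, ?_⟩
  -- Cramér–Wold: the characteristic function at `x` is that of the real projection onto `x`, taken
  -- at `1`.
  refine ProbabilityMeasure.tendsto_iff_tendsto_charFun.2 fun x => ?_
  have hinner : Measurable fun z : EuclideanSpace ℝ κ => inner ℝ z x := by fun_prop
  have hvar : Var[fun ω => inner ℝ (X 0 ω) x; μ] = x ⬝ᵥ S *ᵥ x := by
    rw [variance_eq_integral (X := fun ω => inner ℝ (X 0 ω) x)
      (hinner.comp_aemeasurable (hm 0)), hmean]
    simpa using hcov x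
  have hnn : 0 ≤ x ⬝ᵥ S *ᵥ x := hvar ▸ variance_nonneg _ _
  have h1 := tendstoInDistribution_inv_sqrt_mul_sum_sub (P := μ)
    (X := fun k ω => inner ℝ (X k ω) x)
    (Y := id) (P' := gaussianReal 0 Var[fun ω => inner ℝ (X 0 ω) x; μ].toNNReal)
    HasLaw.id (hX.inner_const x) (hindep.comp _ fun _ => hinner)
    fun i => (hident i).comp hinner
  have h2 := ProbabilityMeasure.tendsto_iff_tendsto_charFun.1 h1.tendsto 1
  simp only [ProbabilityMeasure.coe_mk, Measure.map_id, hmean, mul_zero, sub_zero, hvar] at h2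
  simp only [ProbabilityMeasure.coe_mk, Measure.map_id']
  rw [charFun_gaussianReal] at h2
  rw [charFun_multivariateGaussian hS]
  convert h2 using 2 with n
  · rw [charFun_apply, charFun_apply, integral_map (hW n) (by fun_prop),
      integral_map _ (by fun_prop)]
    · simp [sum_inner, inner_smul_left]
    · exact (Finset.aemeasurable_fun_sum _ fun k _ =>
        hinner.comp_aemeasurable (hm k)).const_mul _
  · simp [Real.coe_toNNReal _ hnn]

/-- If `R N = O_P(N ^ (-1 / 2))` and `T N` is of smaller order than `R N` wherever `R N` is small,
then `√N T N` tends to zero in probability. -/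
theorem tendstoInMeasure_sqrt_smul_of_small {E G : Type*} [NormedAddCommGroup E] [NormedSpace ℝ E]
    [NormedAddCommGroup G] {R : ℕ → Ω → G} {T : ℕ → Ω → E} {C : ℝ}
    (hR : ∀ N ≥ 1, ∀ r > 0, μ.real {ω | r ≤ ‖R N ω‖} ≤ C / (N * r ^ 2))
    (hT : ∀ ε > 0, ∃ δ > 0, ∀ N ≥ 1, ∀ᵐ ω ∂μ, ‖R N ω‖ < δ → ‖T N ω‖ ≤ ε * ‖R N ω‖) :
    TendstoInMeasure μ (fun (N : ℕ) ω => Real.sqrt N • T N ω) atTop 0 := by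
  rw [tendstoInMeasure_iff_measureReal_norm]
  intro η hη
  have hC : 0 ≤ C := by
    simpa using measureReal_nonneg.trans (hR 1 le_rfl 1 one_pos)
  refine Metric.tendsto_nhds.2 fun τ hτ => ?_
  -- Chosen so that the tail bound at `r = η / (ε√N)`, which equals `C ε² / η²` for every `N`, is at
  -- most `τ / 2`; `C + 1` covers `C = 0`.
  set ε := η * Real.sqrt (τ / (2 * (C + 1))) with hε
  have hε0 : 0 < ε := by positivity
  have hε2 : C * ε ^ 2 / η ^ 2 ≤ τ / 2 := by
    rw [hε, mul_pow, Real.sq_sqrt (by positivity)]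
    rw [show C * (η ^ 2 * (τ / (2 * (C + 1)))) / η ^ 2 = C / (C + 1) * (τ / 2) by field_simp]
    have : C / (C + 1) ≤ 1 := by rw [div_le_one (by positivity)]; linarith
    nlinarith
  obtain ⟨δ, hδ, h⟩ := hT ε hε0
  have hlim : Tendsto (fun N : ℕ => C / (N * δ ^ 2)) atTop (𝓝 0) :=
    (tendsto_natCast_atTop_atTop.atTop_mul_const (by positivity)).const_div_atTop C
  filter_upwards [eventually_ge_atTop 1, hlim (gt_mem_nhds (half_pos hτ))] with N hN hN2
  have hN0 : (0 : ℝ) < N := by exact_mod_cast hN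
  have hsq : 0 < Real.sqrt N := Real.sqrt_pos.2 hN0
  have hsub : μ.real {ω | η ≤ ‖Real.sqrt N • T N ω - (0 : Ω → E) ω‖} ≤
      μ.real ({ω | δ ≤ ‖R N ω‖} ∪ {ω | η / (ε * Real.sqrt N) ≤ ‖R N ω‖}) := by
    refine ENNReal.toReal_mono (measure_ne_top _ _) (measure_mono_ae ?_)
    filter_upwards [h N hN] with ω hω (hη' : η ≤ ‖Real.sqrt N • T N ω - (0 : Ω → E) ω‖)
    by_cases hlt : ‖R N ω‖ < δ
    · right
      rw [Pi.zero_apply, sub_zero, norm_smul, Real.norm_of_nonneg hsq.le] at hη'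
      change η / (ε * Real.sqrt N) ≤ ‖R N ω‖
      rw [div_le_iff₀ (by positivity)]
      calc η ≤ Real.sqrt N * ‖T N ω‖ := hη'
        _ ≤ Real.sqrt N * (ε * ‖R N ω‖) := by gcongr; exact hω hlt
        _ = _ := by ring
    · left
      exact not_lt.1 hlt
  have h2 : C / (N * (η / (ε * Real.sqrt N)) ^ 2) = C * ε ^ 2 / η ^ 2 := by
    rw [div_pow, mul_pow, Real.sq_sqrt hN0.le]
    field_simp
  rw [Real.dist_eq, sub_zero, abs_of_nonneg measureReal_nonneg]
  calc _ ≤ _ := hsub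
    _ ≤ _ := measureReal_union_le _ _
    _ ≤ C / (N * δ ^ 2) + C / (N * (η / (ε * Real.sqrt N)) ^ 2) :=
      add_le_add (hR N hN _ hδ) (hR N hN _ (by positivity))
    _ < τ := by
      rw [h2]
      have : C / (N * δ ^ 2) < τ / 2 := hN2
      linarith

end LimitTheorems

/-! ### Sample proportions -/

section Sample

variable {k m t u : ℕ} {M : BinaryLCM k m t u} {θ₀ : LCMParam t u} {Ω : Type*}

lemma cast_patternCount (Y : ℕ → Ω → AnswerPattern k) (N : ℕ) (ω : Ω) (y : AnswerPattern k) :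
    (patternCount Y N ω y : ℝ) =
      ∑ v ∈ Finset.range N, (Pi.single (Y v ω) 1 : AnswerPattern k → ℝ) y := by
  simp only [patternCount, Finset.card_filter, Nat.cast_sum, Pi.single_apply, Nat.cast_ite,
    Nat.cast_one, Nat.cast_zero, eq_comm]

lemma sampleProportion_eq_smul_sum (Y : ℕ → Ω → AnswerPattern k) (N : ℕ) (ω : Ω) :
    sampleProportion Y N ω =
      (N : ℝ)⁻¹ • ∑ v ∈ Finset.range N, (Pi.single (Y v ω) 1 : AnswerPattern k → ℝ) := by
  ext y
  rw [sampleProportion, cast_patternCount, Pi.smul_apply, Finset.sum_apply, smul_eq_mul,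
    div_eq_inv_mul]

lemma sum_sampleProportion (Y : ℕ → Ω → AnswerPattern k) {N : ℕ} (hN : 1 ≤ N) (ω : Ω) :
    ∑ y, sampleProportion Y N ω y = 1 := by
  have hN0 : (N : ℝ) ≠ 0 := by positivity
  simp_rw [sampleProportion, cast_patternCount, ← Finset.sum_div]
  rw [Finset.sum_comm]
  simp [hN0]

variable [MeasurableSpace Ω] {μ : Measure Ω} [IsProbabilityMeasure μ]
  {Y : ℕ → Ω → AnswerPattern k}

lemma IsLCMSample.identDistrib (hY : IsLCMSample M θ₀ μ Y) (v : ℕ) :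
    IdentDistrib (Y v) (Y 0) μ μ := by
  refine ⟨(hY.measurable v).aemeasurable, (hY.measurable 0).aemeasurable, ?_⟩
  refine Measure.ext_of_singleton fun y => ?_
  rw [Measure.map_apply (hY.measurable v) (measurableSet_singleton y),
    Measure.map_apply (hY.measurable 0) (measurableSet_singleton y),
    ← ENNReal.toReal_eq_toReal_iff' (measure_ne_top _ _) (measure_ne_top _ _)]
  exact (hY.law v y).trans (hY.law 0 y).symm

lemma IsLCMSample.integral_comp (hY : IsLCMSample M θ₀ μ Y) (v : ℕ) (f : AnswerPattern k → ℝ) :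
    ∫ ω, f (Y v ω) ∂μ = ∑ y, M.manifestProb θ₀ y * f y := by
  have : IsProbabilityMeasure (μ.map (Y v)) :=
    Measure.isProbabilityMeasure_map (hY.measurable v).aemeasurable
  have hf : Measurable f := .of_discrete
  rw [← integral_map (hY.measurable v).aemeasurable hf.aestronglyMeasurable,
    integral_fintype .of_finite]
  refine Finset.sum_congr rfl fun y _ => ?_
  rw [map_measureReal_apply (hY.measurable v) (measurableSet_singleton y), hY.law, smul_eq_mul]

lemma memLp_comp_of_finite {ι E : Type*} [Finite ι] [MeasurableSpace ι]
    [MeasurableSingletonClass ι] [NormedAddCommGroup E] {X : Ω → ι} (hX : Measurable X)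
    (f : ι → E) (p : ENNReal) : MemLp (fun ω => f (X ω)) p μ := by
  have := Fintype.ofFinite ι
  have hf : StronglyMeasurable f := .of_discrete
  refine MemLp.of_bound (hf.comp_measurable hX).aestronglyMeasurable (∑ i, ‖f i‖)
    (ae_of_all _ fun ω => ?_)
  exact Finset.single_le_sum (f := fun i => ‖f i‖) (fun i _ => norm_nonneg _)
    (Finset.mem_univ (X ω))

/-- Chebyshev in each coordinate, where the mean of `N` independent indicators has variance at most
`1 / N`, then a union bound over the patterns. -/
lemma IsLCMSample.measureReal_le_norm_sub (hY : IsLCMSample M θ₀ μ Y) {N : ℕ} (hN : 1 ≤ N)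
    {r : ℝ} (hr : 0 < r) :
    μ.real {ω | r ≤ ‖sampleProportion Y N ω - M.manifestProb θ₀‖} ≤
      Fintype.card (AnswerPattern k) / (N * r ^ 2) := by
  have hN0 : (0 : ℝ) < N := by exact_mod_cast hN
  have hcoord : ∀ y, μ.real {ω | r ≤ |sampleProportion Y N ω y - M.manifestProb θ₀ y|} ≤
      1 / (N * r ^ 2) := by
    intro y
    set g : ℕ → Ω → ℝ := fun v ω => (Pi.single (Y v ω) 1 : AnswerPattern k → ℝ) y with hg
    have hgL : ∀ v, MemLp (g v) 2 μ := fun v =>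
      memLp_comp_of_finite (hY.measurable v)
        (fun z => (Pi.single z 1 : AnswerPattern k → ℝ) y) 2
    have hgi : iIndepFun g μ := hY.indep.comp
      (fun _ z => (Pi.single z 1 : AnswerPattern k → ℝ) y) fun _ => .of_discrete
    have hmean : ∀ v, ∫ ω, g v ω ∂μ = M.manifestProb θ₀ y := fun v => by
      rw [hY.integral_comp v fun z => (Pi.single z 1 : AnswerPattern k → ℝ) y]
      simp [Pi.single_apply]
    have hvar : ∀ v, Var[g v; μ] ≤ 1 := fun v => by
      refine (variance_le_sq_of_bounded (a := 0) (b := 1) (ae_of_all _ fun ω => ?_)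
        (hgL v).aemeasurable).trans (by norm_num)
      simp only [hg, Pi.single_apply]
      split_ifs <;> simp
    have hsum : (fun ω => sampleProportion Y N ω y) =
        fun ω => (N : ℝ)⁻¹ * (∑ v ∈ Finset.range N, g v) ω := by
      ext ω
      rw [sampleProportion, cast_patternCount, Finset.sum_apply, div_eq_inv_mul]
    have hL : MemLp (fun ω => sampleProportion Y N ω y) 2 μ := by
      rw [hsum]
      exact (memLp_finsetSum' _ fun v _ => hgL v).const_mul _
    have hE : ∫ ω, sampleProportion Y N ω y ∂μ = M.manifestProb θ₀ y := by
      rw [hsum, integral_const_mul]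
      simp only [Finset.sum_apply]
      rw [integral_finsetSum _ fun v _ => (hgL v).integrable (by norm_num)]
      simp [hmean, hN0.ne']
    have hV : Var[fun ω => sampleProportion Y N ω y; μ] ≤ 1 / N := by
      rw [hsum, variance_const_mul, IndepFun.variance_sum (fun v _ => hgL v)
        fun i _ j _ hij => hgi.indepFun hij]
      have := Finset.sum_le_sum fun v (_ : v ∈ Finset.range N) => hvar v
      rw [Finset.sum_const, Finset.card_range, nsmul_eq_mul, mul_one] at this
      calc _ ≤ ((N : ℝ)⁻¹) ^ 2 * N := by gcongr
        _ = 1 / N := by field_simp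
    have h := meas_ge_le_variance_div_sq hL hr
    rw [hE] at h
    refine (ENNReal.toReal_mono ENNReal.ofReal_ne_top h).trans ?_
    rw [ENNReal.toReal_ofReal (div_nonneg (variance_nonneg _ _) (sq_nonneg _)),
      ← div_div]
    gcongr
  have hsub : {ω | r ≤ ‖sampleProportion Y N ω - M.manifestProb θ₀‖} ⊆
      ⋃ y ∈ Finset.univ, {ω | r ≤ |sampleProportion Y N ω y - M.manifestProb θ₀ y|} := by
    intro ω hω
    by_contra hcon
    simp only [Finset.mem_univ, Set.iUnion_true, Set.mem_iUnion, Set.mem_ofPred_eq, not_exists,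
      not_le] at hcon
    exact absurd ((pi_norm_lt_iff hr).2 hcon) (not_lt.2 hω)
  calc _ ≤ _ := measureReal_mono hsub (measure_ne_top _ _)
    _ ≤ _ := measureReal_biUnion_finset_le _ _
    _ ≤ ∑ _y : AnswerPattern k, 1 / (N * r ^ 2) := Finset.sum_le_sum fun y _ => hcoord y
    _ = _ := by rw [Finset.sum_const, nsmul_eq_mul, mul_one_div, Finset.card_univ]

/-- The sample proportions average unit vectors, so this is a normalized sum of i.i.d. bounded
vectors `ξ (Y v)`, centered because the operator kills `p(θ₀)`. -/
lemma IsLCMSample.tendstoInDistribution_leastSquares [Nonempty (Fin m)]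
    (hY : IsLCMSample M θ₀ μ Y) (hrank : (M.jacobian θ₀).rank = t + u)
    (hd : DifferentiableAt ℝ M.manifestProb θ₀) :
    TendstoInDistribution (fun (N : ℕ) ω => Real.sqrt N • M.leastSquares θ₀
        (invSqrtScale (M.manifestProb θ₀) (sampleProportion Y N ω - M.manifestProb θ₀))) atTop
      (fun x : LCMParam t u => x) (fun _ => μ)
      (multivariateGaussian 0 ((M.scaledJacobian θ₀)ᵀ * M.scaledJacobian θ₀)⁻¹) := by
  set ξ : AnswerPattern k → LCMParam t u := fun y =>
    M.leastSquares θ₀ (invSqrtScale (M.manifestProb θ₀) (Pi.single y 1)) with hξ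
  have hpos := M.manifestProb_pos θ₀
  have hξm : Measurable ξ := .of_discrete
  have hmean : ∑ y, M.manifestProb θ₀ y • ξ y = 0 := by
    have he : ∑ y, M.manifestProb θ₀ y • (Pi.single y 1 : AnswerPattern k → ℝ) =
        M.manifestProb θ₀ := by
      ext z
      simp [Finset.sum_apply, Pi.single_apply]
    simp only [hξ, ← map_smul, ← map_sum]
    rw [he, BinaryLCM.leastSquares_invSqrtScale_self hd]
  have h := tendstoInDistribution_inv_sqrt_smul_sum (μ := μ) (X := fun v ω => ξ (Y v ω))
    (S := ((M.scaledJacobian θ₀)ᵀ * M.scaledJacobian θ₀)⁻¹)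
    (BinaryLCM.posDef_transpose_mul_scaledJacobian hpos hrank).inv.posSemidef
    (memLp_comp_of_finite (hY.measurable 0) ξ 2)
    (fun x => by
      rw [hY.integral_comp 0 fun y => inner ℝ (ξ y) x]
      simp_rw [← real_inner_smul_left]
      rw [← sum_inner, hmean, inner_zero_left])
    (fun x => by
      rw [hY.integral_comp 0 fun y => inner ℝ (ξ y) x ^ 2]
      exact BinaryLCM.sum_inner_leastSquares_sq hpos hrank x)
    (hY.indep.comp (fun _ => ξ) fun _ => hξm) (fun i => (hY.identDistrib i).comp hξm)
  refine h.congr (fun N => ae_of_all _ fun ω => ?_) EventuallyEq.rfl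
  simp only [hξ, ← map_sum]
  rw [map_sub, map_sub, BinaryLCM.leastSquares_invSqrtScale_self hd, sub_zero,
    sampleProportion_eq_smul_sum, map_smul, map_smul, smul_smul]
  congr 1
  -- It remains that `√N * N⁻¹ = (√N)⁻¹`; at `N = 0` both sides are `0`.
  rcases Nat.eq_zero_or_pos N with rfl | hN
  · simp
  · have : (0 : ℝ) < N := by exact_mod_cast hN
    have h1 := Real.mul_self_sqrt this.le
    have h2 := Real.sqrt_pos.2 this
    field_simp
    rw [sq, h1]

/-- An estimator that is asymptotically a least squares solution is asymptotically normal. -/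
lemma IsLCMSample.tendstoInDistribution_of_norm_sub_le [Nonempty (Fin m)]
    (hY : IsLCMSample M θ₀ μ Y) (hrank : (M.jacobian θ₀).rank = t + u)
    (hd : DifferentiableAt ℝ M.manifestProb θ₀) {T : ℕ → Ω → LCMParam t u}
    (hT : ∀ N, AEMeasurable (T N) μ)
    (h : ∀ ε > 0, ∃ δ > 0, ∀ N ≥ 1, ∀ᵐ ω ∂μ,
      ‖sampleProportion Y N ω - M.manifestProb θ₀‖ < δ →
        ‖T N ω - θ₀ - M.leastSquares θ₀
          (invSqrtScale (M.manifestProb θ₀) (sampleProportion Y N ω - M.manifestProb θ₀))‖ ≤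
            ε * ‖sampleProportion Y N ω - M.manifestProb θ₀‖) :
    TendstoInDistribution (fun (N : ℕ) ω => Real.sqrt N • (T N ω - θ₀)) atTop
      (fun x : LCMParam t u => x) (fun _ => μ)
      (multivariateGaussian 0 ((M.scaledJacobian θ₀)ᵀ * M.scaledJacobian θ₀)⁻¹) := by
  refine tendstoInDistribution_of_tendstoInMeasure_sub _ _
    (hY.tendstoInDistribution_leastSquares hrank hd) ?_
    fun N => ((hT N).sub_const θ₀).const_smul (Real.sqrt N)
  have := tendstoInMeasure_sqrt_smul_of_small
    (fun N hN r hr => hY.measureReal_le_norm_sub hN hr) h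
  refine this.congr' (Eventually.of_forall fun N => ae_of_all _ fun ω => ?_) EventuallyEq.rfl
  simp only [Pi.sub_apply, smul_sub]

end Sample

/-! ### From the estimators to the deterministic estimate -/

section Reduction

variable {k m t u : ℕ} {M : BinaryLCM k m t u} {Θ : Set (LCMParam t u)} {θ₀ : LCMParam t u}
  {φ : ℝ → ℝ}

lemma phiDivergence_eq_coe {ι : Type*} [Fintype ι] (φ : ℝ → ℝ) {p q : ι → ℝ}
    (hp : ∀ y, 0 < p y) (hq : ∀ y, 0 < q y) :
    phiDivergence φ p q = (realDivergence φ p q : EReal) := by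
  have hterm : ∀ y, phiTerm φ (p y) (q y) = ((q y * φ (p y / q y) : ℝ) : EReal) := fun y => by
    rw [phiTerm, if_neg (hq y).ne', phiExt, if_neg (div_pos (hp y) (hq y)).ne', EReal.coe_mul]
  have hsum : ∀ (s : Finset ι) (f : ι → ℝ), ∑ y ∈ s, (f y : EReal) = ((∑ y ∈ s, f y : ℝ) : EReal) :=
    fun s f => by
      classical
      induction s using Finset.induction_on with
      | empty => simp
      | insert a s ha ih => rw [Finset.sum_insert ha, Finset.sum_insert ha, ih, EReal.coe_add]
  simp_rw [phiDivergence, hterm, hsum, realDivergence]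

/-- The linear term contributes `c ∑ (p - q) = 0`. -/
lemma realDivergence_sub_linear {ι : Type*} [Fintype ι] (φ : ℝ → ℝ) (c : ℝ) {p q : ι → ℝ}
    (hq : ∀ y, 0 < q y) (h : ∑ y, p y = ∑ y, q y) :
    realDivergence (fun x => φ x - c * (x - 1)) p q = realDivergence φ p q := by
  have h1 : ∀ y, q y * (φ (p y / q y) - c * (p y / q y - 1)) =
      q y * φ (p y / q y) - c * (p y - q y) := fun y => by
    have := (hq y).ne'
    field_simp
  simp_rw [realDivergence, h1, Finset.sum_sub_distrib, ← Finset.mul_sum, Finset.sum_sub_distrib, h]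
  simp

/-- The radius `δ` depends on neither `N` nor the sample. Positivity of `P` makes the conventions at
zero irrelevant. -/
lemma BinaryLCM.BirchConditions.eventually_minimizers [Nonempty (Fin m)]
    (hB : M.BirchConditions Θ θ₀) (hθ₀ : θ₀ ∈ interior Θ) (hφ : IsDivergenceFunction φ)
    (hC : ContDiffOn ℝ 2 φ (Set.Ioi 0)) (hφ1 : deriv (deriv φ) 1 ≠ 0) {ε : ℝ} (hε : 0 < ε) :
    ∃ δ > 0, ∀ P : AnswerPattern k → ℝ, ∑ y, P y = 1 → ‖P - M.manifestProb θ₀‖ < δ →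
      (∀ y, 0 < P y) ∧
      (∃ θ ∈ Θ, IsMinOn (fun θ' => realDivergence φ P (M.manifestProb θ')) Θ θ) ∧
      ∀ θ ∈ Θ, IsMinOn (fun θ' => realDivergence φ P (M.manifestProb θ')) Θ θ →
        ‖θ - θ₀ - M.leastSquares θ₀ (invSqrtScale (M.manifestProb θ₀) (P - M.manifestProb θ₀))‖ ≤
          ε * ‖P - M.manifestProb θ₀‖ := by
  have hψ := hφ.isNormalizedDivergence hC hφ1
  have hψc : ContinuousOn (fun x => φ x - deriv φ 1 * (x - 1)) (Set.Ioi 0) :=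
    hC.continuousOn.sub (by fun_prop)
  have hd := hB.differentiableAt
  have hA : Function.Injective
      (invSqrtScale (M.manifestProb θ₀) ∘L fderiv ℝ M.manifestProb θ₀) := fun v w hvw => by
    simp only [ContinuousLinearMap.comp_apply, ← BinaryLCM.scaledJacobian_mulVec hd] at hvw
    exact WithLp.ofLp_injective _ (BinaryLCM.mulVec_scaledJacobian_injective hB.pos
      hB.rank_jacobian (WithLp.toLp_injective _ hvw))
  have h1 := hψ.eventually_exists_isMinOn hψc M.manifestProb_pos M.sum_manifestProb
    M.continuous_manifestProb hθ₀ hB.inverse_continuousAt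
  have h2 := hψ.eventually_norm_sub_leastSquares_le M.manifestProb_pos M.sum_manifestProb hθ₀
    hB.inverse_continuousAt hd.hasFDerivAt hA
    (BinaryLCM.inner_sub_leastSquares hB.pos hB.rank_jacobian hd) hε
  obtain ⟨δ, hδ, h⟩ := Metric.eventually_nhds_iff.1
    ((h1.and h2).and (eventually_forall_pos hB.pos))
  refine ⟨δ, hδ, fun P hP hPδ => ?_⟩
  obtain ⟨⟨h3, h4⟩, h5⟩ := h (y := P) (by rwa [dist_eq_norm])
  have he : (fun θ' => realDivergence (fun x => φ x - deriv φ 1 * (x - 1)) P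
      (M.manifestProb θ')) = fun θ' => realDivergence φ P (M.manifestProb θ') := by
    ext θ'
    exact realDivergence_sub_linear φ _ (M.manifestProb_pos θ') (hP.trans
      (M.sum_manifestProb θ').symm)
  rw [he] at h3 h4
  exact ⟨h5, h3 hP, h4 hP⟩

lemma isMinOn_phiDivergence_iff [Nonempty (Fin m)] {P : AnswerPattern k → ℝ} (hP : ∀ y, 0 < P y)
    {θ : LCMParam t u} :
    IsMinOn (fun θ' => phiDivergence φ P (M.manifestProb θ')) Θ θ ↔
      IsMinOn (fun θ' => realDivergence φ P (M.manifestProb θ')) Θ θ := by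
  simp only [isMinOn_iff, phiDivergence_eq_coe φ hP (M.manifestProb_pos _), EReal.coe_le_coe_iff]

/-- The log-likelihood is `N` times (a constant minus the Kullback–Leibler divergence). -/
lemma isMaxOn_logLikelihood_iff [Nonempty (Fin m)] {Ω : Type*} {Y : ℕ → Ω → AnswerPattern k}
    {N : ℕ} (hN : 1 ≤ N) {ω : Ω} (hP : ∀ y, 0 < sampleProportion Y N ω y) {θ : LCMParam t u} :
    IsMaxOn (logLikelihood M Y N ω) Θ θ ↔
      IsMinOn (fun θ' => realDivergence (fun x => x * Real.log x) (sampleProportion Y N ω)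
        (M.manifestProb θ')) Θ θ := by
  have hN0 : (0 : ℝ) < N := by exact_mod_cast hN
  set P := sampleProportion Y N ω with hPdef
  have h1 : ∀ θ', logLikelihood M Y N ω θ' = N * (∑ y, P y * Real.log (P y) -
      realDivergence (fun x => x * Real.log x) P (M.manifestProb θ')) := fun θ' => by
    rw [logLikelihood, realDivergence, ← Finset.sum_sub_distrib, Finset.mul_sum]
    refine Finset.sum_congr rfl fun y _ => ?_
    have hq := M.manifestProb_pos θ' y
    have hc : (patternCount Y N ω y : ℝ) = N * P y := by
      rw [hPdef, sampleProportion]; field_simp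
    rw [Real.log_div (hP y).ne' hq.ne', hc]
    field_simp
    ring
  simp only [isMaxOn_iff, isMinOn_iff, h1, mul_le_mul_iff_right₀ hN0, sub_le_sub_iff_left]

lemma isDivergenceFunction_mul_log : IsDivergenceFunction fun x => x * Real.log x :=
  ⟨Real.convexOn_mul_log.subset Set.Ioi_subset_Ici_self (convex_Ioi 0), by simp⟩

lemma contDiffOn_mul_log : ContDiffOn ℝ 2 (fun x => x * Real.log x) (Set.Ioi 0) :=
  contDiffOn_id.mul (Real.contDiffOn_log.mono fun _ hx => (ne_of_gt hx))

lemma deriv_deriv_mul_log_one : deriv (deriv fun x => x * Real.log x) 1 ≠ 0 := by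
  have := Real.deriv2_mul_log 1
  simp only [Function.iterate_succ, Function.iterate_zero, Function.comp, id] at this
  rw [this]
  norm_num

end Reduction

theorem theorem2 {k m t u : ℕ} (M : BinaryLCM k m t u) (Θ : Set (LCMParam t u))
    (θ₀ : LCMParam t u) (hθ₀ : θ₀ ∈ interior Θ) (hBirch : M.BirchConditions Θ θ₀)
    {Ω : Type*} [MeasurableSpace Ω] (μ : Measure Ω) [IsProbabilityMeasure μ]
    (Y : ℕ → Ω → AnswerPattern k) (hY : IsLCMSample M θ₀ μ Y)
    (φ : ℝ → ℝ) (hφ : IsDivergenceFunction φ) (hφC2 : ContDiffOn ℝ 2 φ (Set.Ioi 0))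
    (hφ1 : deriv (deriv φ) 1 ≠ 0) :
    ((M.scaledJacobian θ₀)ᵀ * M.scaledJacobian θ₀).PosDef ∧
    (M.scaledJacobian θ₀)ᵀ * M.scaledJacobian θ₀ = M.fisherInformation θ₀ ∧
    (∀ θhat : ℕ → Ω → LCMParam t u, IsMinPhiDivergenceEstimator M Θ φ μ Y θhat →
      TendstoInDistribution (fun (N : ℕ) ω => Real.sqrt N • (θhat N ω - θ₀)) atTop
        (fun x : LCMParam t u => x) (fun _ => μ)
        (multivariateGaussian 0 ((M.scaledJacobian θ₀)ᵀ * M.scaledJacobian θ₀)⁻¹)) ∧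
    (∀ θtilde : ℕ → Ω → LCMParam t u, IsMaxLikelihoodEstimator M Θ μ Y θtilde →
      TendstoInDistribution (fun (N : ℕ) ω => Real.sqrt N • (θtilde N ω - θ₀)) atTop
        (fun x : LCMParam t u => x) (fun _ => μ)
        (multivariateGaussian 0 ((M.scaledJacobian θ₀)ᵀ * M.scaledJacobian θ₀)⁻¹)) := by
  -- Without classes every pattern probability would be an empty sum, against positivity.
  have hm : Nonempty (Fin m) := by
    by_contra hempty
    rw [not_nonempty_iff] at hempty
    simpa [BinaryLCM.manifestProb] using hBirch.pos fun _ => true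
  have hd := hBirch.differentiableAt
  have hrank := hBirch.rank_jacobian
  refine ⟨BinaryLCM.posDef_transpose_mul_scaledJacobian hBirch.pos hrank,
    BinaryLCM.transpose_mul_scaledJacobian_eq_fisherInformation hBirch.pos hd,
    fun T hT => ?_, fun T hT => ?_⟩
  · refine hY.tendstoInDistribution_of_norm_sub_le hrank hd hT.1 fun ε hε => ?_
    obtain ⟨δ, hδ, h⟩ := hBirch.eventually_minimizers hθ₀ hφ hφC2 hφ1 hε
    refine ⟨δ, hδ, fun N hN => ?_⟩
    filter_upwards [hT.2 N hN] with ω hω hωδ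
    -- `hex` discharges the proviso in the definition of the estimator.
    obtain ⟨hpos, hex, hall⟩ := h _ (sum_sampleProportion Y hN ω) hωδ
    simp only [isMinOn_phiDivergence_iff hpos] at hω
    exact hall _ (hω hex).1 (hω hex).2
  · refine hY.tendstoInDistribution_of_norm_sub_le hrank hd hT.1 fun ε hε => ?_
    obtain ⟨δ, hδ, h⟩ := hBirch.eventually_minimizers hθ₀ isDivergenceFunction_mul_log
      contDiffOn_mul_log deriv_deriv_mul_log_one hε
    refine ⟨δ, hδ, fun N hN => ?_⟩
    filter_upwards [hT.2 N hN] with ω hω hωδ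
    obtain ⟨hpos, hex, hall⟩ := h _ (sum_sampleProportion Y hN ω) hωδ
    simp only [isMaxOn_logLikelihood_iff hN hpos] at hω
    exact hall _ (hω hex).1 (hω hex).2
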